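/- Let $n\ge 1$. On velocity space $\mathbb R^n_c$ let $\psi^0(c)=(2\pi)^{-n/2}e^{-|c|^2/2}$, let $\psi^\alpha=(-\partial_c)^\alpha\psi^0$ ($\alpha\in\mathbb N_0^n$) be the Hermite functions, and let $L^2_w$ be the space $L^2(\mathbb R^n_c;\,w(c)\,dc)$ of complex-valued functions with $w=1/\psi^0$. For $f\in L^2_w$ the coefficients in the expansion $f=\sum_\alpha\frac1{\alpha!}m_\alpha\psi^\alpha$ are $m_\alpha=\int f\,\psi^\alpha\,w\,dc$. For $N\in\mathbb N_0$, the $N$-th Hermite--Grad Galerkin system of the kinetic Fokker--Planck equation $(\partial_t+c\cdot\nabla_x)f=\nabla_c\cdot(c+\nabla_c)f$ is the system for $m=(m_\beta(t,x))_{|\beta|\le N}$ $$\partial_t m_\beta+\sum_{j=1}^n\big(\beta_j\,\partial_{x_j}m_{\beta-e_j}+\partial_{x_j}m_{\beta+e_j}\big)+|\beta|\,m_\beta=0,\qquad |\beta|\le N,$$ in which terms with an index outside $\{\alpha\in\mathbb N_0^n:|\alpha|\le N\}$ are dropped; that is, $\partial_t m+\sum_j A_j\partial_{x_j}m+Bm=0$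 with $B=\mathrm{diag}(|\beta|)$. The $N$-th Fokker--Planck polynomial is $$P(\tau,\xi)=\det\Big(\tau I+\sum_{j=1}^n\xi_jA_j-iB\Big),\qquad \tau\in\mathbb C,\ \xi\in\mathbb R^n.$$ It is called strongly stable if its roots $\tau(\xi)$ (the solutions $\tau$ of $P(\tau,\xi)=0$) satisfy: $\operatorname{Im}\tau(\xi)\ge0$ for all $\xi\in\mathbb R^n$; $\operatorname{Im}\tau(\xi)=0$ implies $\xi=0$ and $\operatorname{Re}\tau(\xi)=0$; and $\liminf_{|\xi|\to\infty}\operatorname{Im}\tau(\xi)>0$. Let $s>n$, and let $W^s_1(\mathbb R^n_x;L^2_w)$ be the Sobolev space with norm $\|f_0\|_{W^s_1L^2_w}=\int_{\mathbb R^n}\|\langle D_x\rangle^sf_0(x,\cdot)\|_{L^2_w}\,dx$, $\langle D_x\rangle=(1-\Delta_x)^{1/2}$. For $f_0\in W^s_1(\mathbb R^n_x;L^2_w)$ the Galerkin approximation is $$f_N(t,x,c)=\sum_{|\alpha|\le N}\frac1{\alpha!}\,m_\alpha(t,x)\,\psi^\alpha(c),$$ where $m\in C([0,\infty);L^2(\mathbb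 R^n_x))$ is the solution, with $x$-derivatives in the sense of distributions, of the $N$-th Galerkin system with $m_\beta(0,x)=\int f_0(x,c)\psi^\beta(c)w(c)\,dc$ for $|\beta|\le N$. Then there is a constant $C>0$, depending only on $n$ and $s$ (in particular independent of $N$), such that for every $N$ for which the $N$-th Fokker--Planck polynomial is strongly stable there are $C_N>0$ and $\epsilon(N)>0$ with $$\|f_N(t,x,c)\|_{L^\infty(\mathbb R^n_x)L^2_w(\mathbb R^n_c)}\le\Big(C(1+t)^{-n/2}+C_Ne^{-\epsilon(N)t}\Big)\,\|f_0\|_{W^s_1L^2_w}\qquad\text{for all }t\ge0$$ and all $f_0\in W^s_1(\mathbb R^n_x;L^2_w)$. The same bound holds if on the left-hand side the weight $w=1/\psi^0$ is replaced by $e^{-|c|^2/2}$. -/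

import Mathlib

open MeasureTheory Set Filter Topology FourierTransform
open scoped ENNReal ContDiff

noncomputable section

namespace FokkerPlanck

/-- Position space and velocity space `ℝⁿ`. -/
abbrev Space (n : ℕ) : Type := EuclideanSpace ℝ (Fin n)

/-- Multi-indices `α ∈ ℕⁿ` with `|α| ≤ N`. -/
abbrev MultiIdx (n N : ℕ) : Type := {α : Fin n → ℕ // ∑ i, α i ≤ N}

instance (n N : ℕ) : Finite (MultiIdx n N) :=
  Finite.of_injective
    (fun (α : MultiIdx n N) (i : Fin n) =>
      (⟨α.1 i, Nat.lt_succ_of_le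
        ((Finset.single_le_sum (fun _ _ => Nat.zero_le _) (Finset.mem_univ i)).trans α.2)⟩ :
        Fin (N + 1)))
    (fun _ _ h => Subtype.ext (funext fun i => congrArg Fin.val (congrFun h i)))

instance (n N : ℕ) : Fintype (MultiIdx n N) := Fintype.ofFinite _

/-! ### Hermite functions and the weighted space -/

/-- The Maxwell distribution `(2π)^{-n/2} exp(-|c|²/2)`. -/
def maxwellian (n : ℕ) (c : Space n) : ℝ :=
  (2 * Real.pi) ^ (-(n : ℝ) / 2) * Real.exp (-‖c‖ ^ 2 / 2)

/-- The operator `-∂_{c_i}`. -/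
def negPartial {n : ℕ} (i : Fin n) (g : Space n → ℝ) : Space n → ℝ :=
  fun c => -(fderiv ℝ g c (EuclideanSpace.single i 1))

/-- The operator `(-∂_c)^α = (-∂_{c_1})^{α_1} ⋯ (-∂_{c_n})^{α_n}`. -/
def negDeriv {n : ℕ} (α : Fin n → ℕ) (g : Space n → ℝ) : Space n → ℝ :=
  (List.finRange n).foldr (fun i h => (negPartial i)^[α i] h) g

/-- The Hermite function `ψ^α = (-∂_c)^α ψ^0`, with `ψ^0` the Maxwell distribution. -/
def hermiteFn {n : ℕ} (α : Fin n → ℕ) : Space n → ℝ :=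
  negDeriv α (maxwellian n)

/-- The measure `w(c) dc` on velocity space with `w = 1 / ψ^0`. -/
def velMeasure (n : ℕ) : Measure (Space n) :=
  volume.withDensity fun c => ENNReal.ofReal (1 / maxwellian n c)

/-- The measure `exp(-|c|²/2) dc` on velocity space. -/
def gaussMeasure (n : ℕ) : Measure (Space n) :=
  volume.withDensity fun c => ENNReal.ofReal (Real.exp (-‖c‖ ^ 2 / 2))

/-- The Hilbert space `L²_w`, `w = 1 / ψ^0`, of functions of the velocity. -/
abbrev L2w (n : ℕ) : Type := Lp ℂ 2 (velMeasure n)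

/-- The moment `m_α = ⟨f, ψ^α⟩_{L²_w}`, so that `f = ∑_α (1/α!) m_α ψ^α` in `L²_w`. -/
def moment {n : ℕ} (α : Fin n → ℕ) (f : L2w n) : ℂ :=
  ∫ c, f c * (hermiteFn α c : ℂ) ∂(velMeasure n)

/-! ### The Galerkin system and its dispersion polynomial -/

/-- The matrix `A_j`: the row `β` of `A_j m` is `β_j m_{β - e_j} + m_{β + e_j}`,
where entries `m_α` with `α ∉ ℕⁿ` or `|α| > N` are dropped. -/
def transportMatrix (n N : ℕ) (j : Fin n) : Matrix (MultiIdx n N) (MultiIdx n N) ℂ :=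
  Matrix.of fun β α =>
    if α.1 + Pi.single j 1 = β.1 then (β.1 j : ℂ)
    else if α.1 = β.1 + Pi.single j 1 then 1
    else 0

/-- The matrix `B = diag(|β|)`. -/
def collisionMatrix (n N : ℕ) : Matrix (MultiIdx n N) (MultiIdx n N) ℂ :=
  Matrix.diagonal fun β => ((∑ i, β.1 i : ℕ) : ℂ)

/-- The `N`-th Fokker–Planck polynomial `P(τ, ξ) = det(τ I + ∑_j ξ_j A_j - i B)`. -/
def fpPolynomial (n N : ℕ) (τ : ℂ) (ξ : Space n) : ℂ :=
  (τ • (1 : Matrix (MultiIdx n N) (MultiIdx n N) ℂ)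
    + ∑ j, (ξ j : ℂ) • transportMatrix n N j - Complex.I • collisionMatrix n N).det

/-- Stability: the roots `τ(ξ)` satisfy `Im τ(ξ) ≥ 0`, with `Im τ(ξ) = 0` only for `ξ = 0`. -/
def IsStable {n : ℕ} (P : ℂ → Space n → ℂ) : Prop :=
  ∀ ξ τ, P τ ξ = 0 → 0 ≤ τ.im ∧ (τ.im = 0 → ξ = 0)

/-- Strong stability: moreover a root can be real only if it is `0` (and `ξ = 0`), and
`liminf_{|ξ| → ∞} Im τ(ξ) > 0` for the roots. -/
structure IsStronglyStable {n : ℕ} (P : ℂ → Space n → ℂ) : Prop where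
  stable : IsStable P
  real_root : ∀ ξ τ, P τ ξ = 0 → τ.im = 0 → ξ = 0 ∧ τ.re = 0
  liminf_pos : ∃ δ > 0, ∀ᶠ ξ in Bornology.cobounded (Space n), ∀ τ, P τ ξ = 0 → δ ≤ τ.im

/-- `G = ⟨D⟩^s F` with `F, G ∈ L¹(ℝⁿ_x; L²_w)`, where `⟨D⟩ = (1 - Δ_x)^{1/2}`. This says that
`F` belongs to the Sobolev space `W^s_1(ℝⁿ_x; L²_w)` and its norm there is `∫ ‖G(x)‖ dx`.
With the Fourier transform `∫ exp(-2πi x·ξ) F(x) dx` the symbol of `⟨D⟩^s` is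
`(1 + |2πξ|²)^{s/2}`. -/
structure IsJapaneseDeriv {n : ℕ} (s : ℝ) (F G : Space n → L2w n) : Prop where
  integrable_left : Integrable F
  integrable_right : Integrable G
  fourier_eq : ∀ ξ : Space n,
    𝓕 G ξ = (((1 + (2 * Real.pi * ‖ξ‖) ^ 2) ^ (s / 2) : ℝ) : ℂ) • 𝓕 F ξ

/-- `m ∈ C([0,∞); L²(ℝⁿ_x))` is the solution of the `N`-th Galerkin system
`∂_t m_β + ∑_j (A_j ∂_{x_j} m)_β + |β| m_β = 0`, `|β| ≤ N`, the derivatives in `x` being taken in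
the sense of distributions, whose initial values are the moments `|β| ≤ N` of `F`. -/
structure IsGalerkinSolution {n : ℕ} (N : ℕ) (F : Space n → L2w n)
    (m : ℝ → MultiIdx n N → Lp ℂ 2 (volume : Measure (Space n))) : Prop where
  continuousOn : ContinuousOn m (Ici 0)
  initial : ∀ β, m 0 β =ᵐ[volume] fun x => moment β.1 (F x)
  weak : ∀ φ : Space n → ℂ, ContDiff ℝ ∞ φ → HasCompactSupport φ → ∀ β, ∀ t ∈ Ici (0 : ℝ),
    HasDerivWithinAt (fun r => ∫ x, m r β x * φ x)
      ((∑ j, ∑ α, transportMatrix n N j β α *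
          (∫ x, m t α x * fderiv ℝ φ x (EuclideanSpace.single j 1)))
        - (∑ α, collisionMatrix n N β α * (∫ x, m t α x * φ x)))
      (Ici 0) t

/-- The Galerkin approximation `f_N(t,x,c) = ∑_{|α| ≤ N} (1/α!) m_α(t,x) ψ^α(c)`. -/
def galerkinApprox {n N : ℕ} (m : ℝ → MultiIdx n N → Lp ℂ 2 (volume : Measure (Space n)))
    (t : ℝ) (x c : Space n) : ℂ :=
  ∑ α : MultiIdx n N,
    (1 / ((∏ i, (α.1 i).factorial : ℕ) : ℂ)) * m t α x * (hermiteFn α.1 c : ℂ)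

/-- The mixed norm `ess sup_x ‖f(x, ·)‖_{L²(μ)}`. -/
def mixedNorm {n : ℕ} (μ : Measure (Space n)) (f : Space n → Space n → ℂ) : ℝ≥0∞ :=
  essSup (fun x => eLpNorm (f x) 2 μ) volume

end FokkerPlanck

end

open scoped BoundedContinuousFunction

noncomputable section

namespace FokkerPlanck

/-! ### One-dimensional Hermite functions -/

/-! After a Fourier transform in `x` the system becomes, with `k = 2πξ`, the linear ODE `y' = -M(k)
y`, `M(k) = i ∑ k_j A_j + B`. In the norm `∑ |y_β|²/β!`, which is the `L²_w` norm of the Hermite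
expansion (`eLpNorm_hermite_sum`), the matrices `A_j` are symmetric, so the energy is dissipated
only by `B` (`sum_inner_symbolMatrix`). This dissipation controls every moment of positive order
with constant 1, but not the mass `y_0`.

The mass is reached by hypocoercivity. The momentum equation contains `i|k|² y_0`, so adding to the
energy a small multiple of `Re⟨y_0, -i k·y_1⟩/(1+|k|²)`, with `k·y_1` the momentum along `k`,
produces a damping term `-|k|²|y_0|²`. The errors involve only moments of order at most two; hence
all constants depend on `n` alone. The outcome is `weightSq_decay`: each mode decays at a rate
comparable to `|k|²/(1+|k|²)`, uniformly in `N ≥ 1`. Strong stability enters through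
`one_le_of_isStronglyStable`, which excludes `N = 0`, where the mass never decays.

Bessel's inequality and `‖𝓕 F(ξ)‖ ≤ (1+|k|²)^(-s/2) ‖G‖_{L¹}` bound the initial modes. Integrating
the resulting majorant over `ξ`, frequencies `|k| ≤ 1` are dominated by a Gaussian in `√(1+t) ξ`,
which gives `(1+t)^(-n/2)`, and the others decay exponentially with a weight integrable because `s >
n`. Fourier inversion turns this into the supremum bound (`norm_weightVec_le_integral`). The
constants `C_N` and `ε` so obtained are also independent of `N`.

The solution is given only as a continuous `L²`-valued weak solution, so one must show that its
transform is `exp(-tM)` applied to the initial transform (`lpHat_ae_eq_flow`). This is a duality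
argument: pairing the solution with the backward adjoint flow times a test function gives a quantity
constant in time (`integral_lpHat_eq`). -/

/-- The unnormalised one-dimensional Hermite function `He_k(x) exp(-x²/2)`. -/
def hermiteGauss (k : ℕ) (x : ℝ) : ℝ :=
  Polynomial.aeval x (Polynomial.hermite k) * Real.exp (-(x ^ 2 / 2))

/-- The Appell property of the Hermite polynomials, which makes repeated integration by parts lower
both indices of an orthogonality integral. -/
theorem derivative_hermite_succ (k : ℕ) :
    Polynomial.derivative (Polynomial.hermite (k + 1)) =
      ((k : Polynomial ℤ) + 1) * Polynomial.hermite k := by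
  induction k with
  | zero => simp
  | succ k ih =>
    rw [Polynomial.hermite_succ (k + 1)]
    simp only [Polynomial.derivative_sub, Polynomial.derivative_mul, Polynomial.derivative_X, ih,
      Polynomial.derivative_add, Polynomial.derivative_natCast, Polynomial.derivative_one]
    rw [Polynomial.hermite_succ k]
    push_cast
    ring

theorem hasDerivAt_hermiteGauss (k : ℕ) (x : ℝ) :
    HasDerivAt (hermiteGauss k) (-hermiteGauss (k + 1) x) x := by
  have h1 : HasDerivAt (fun y : ℝ => Polynomial.aeval y (Polynomial.hermite k))
      (Polynomial.aeval x (Polynomial.derivative (Polynomial.hermite k))) x :=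
    Polynomial.hasDerivAt_aeval _ _
  have h2 : HasDerivAt (fun y : ℝ => Real.exp (-(y ^ 2 / 2)))
      (Real.exp (-(x ^ 2 / 2)) * (-x)) x := by
    apply HasDerivAt.exp
    exact ((hasDerivAt_pow 2 x).div_const 2).neg.congr_deriv (by simp)
  refine (h1.mul h2).congr_deriv ?_
  simp only [hermiteGauss, Polynomial.hermite_succ, map_sub, map_mul, Polynomial.aeval_X]
  ring

theorem integrable_polynomial_mul_gauss (p : Polynomial ℝ) :
    Integrable fun x : ℝ => p.eval x * Real.exp (-(x ^ 2 / 2)) := by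
  induction p using Polynomial.induction_on' with
  | add p q hp hq =>
    simp only [Polynomial.eval_add, add_mul]
    exact hp.add hq
  | monomial k a =>
    have h := integrable_rpow_mul_exp_neg_mul_sq (b := 1 / 2) (by norm_num) (s := (k : ℝ))
      (by have : (0 : ℝ) ≤ k := k.cast_nonneg
          linarith)
    convert h.const_mul a using 2 with x
    rw [Polynomial.eval_monomial, Real.rpow_natCast]
    ring_nf

theorem eval_map_hermite (k : ℕ) (x : ℝ) :
    ((Polynomial.hermite k).map (algebraMap ℤ ℝ)).eval x =
      Polynomial.aeval x (Polynomial.hermite k) := by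
  rw [Polynomial.eval_map_algebraMap]

theorem integrable_polynomial_mul_hermiteGauss (p : Polynomial ℝ) (k : ℕ) :
    Integrable fun x : ℝ => p.eval x * hermiteGauss k x := by
  convert integrable_polynomial_mul_gauss
    (p * (Polynomial.hermite k).map (algebraMap ℤ ℝ)) using 2 with x
  rw [Polynomial.eval_mul, eval_map_hermite, hermiteGauss]
  ring

/-- Integration by parts on the whole line; integrability of the products replaces the boundary
terms. -/
theorem integral_polynomial_mul_hermiteGauss_succ (p : Polynomial ℝ) (k : ℕ) :
    ∫ x, p.eval x * hermiteGauss (k + 1) x =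
      ∫ x, (Polynomial.derivative p).eval x * hermiteGauss k x := by
  have h := integral_mul_deriv_eq_deriv_mul_of_integrable (u := fun x => p.eval x)
    (v := hermiteGauss k) (u' := fun x => (Polynomial.derivative p).eval x)
    (v' := fun x => -hermiteGauss (k + 1) x)
    (fun x _ => p.hasDerivAt x) (fun x _ => hasDerivAt_hermiteGauss k x)
    (by
      refine (integrable_polynomial_mul_hermiteGauss p (k + 1)).neg.congr (ae_of_all _ fun x => ?_)
      simp)
    (integrable_polynomial_mul_hermiteGauss _ k) (integrable_polynomial_mul_hermiteGauss p k)
  simp only [mul_neg, integral_neg] at h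
  linarith

/-- Each integration by parts trades `(a+1, b+1)` for `(a, b)` at the price of a factor `a+1`. The
recursion ends at the Gaussian integral, or at an integral with exactly one index zero, which
vanishes. -/
theorem integral_hermite_mul_hermiteGauss (a b : ℕ) :
    ∫ x, Polynomial.aeval x (Polynomial.hermite a) * hermiteGauss b x =
      if a = b then (a.factorial : ℝ) * Real.sqrt (2 * Real.pi) else 0 := by
  induction b generalizing a with
  | zero =>
    cases a with
    | zero =>
      have := integral_gaussian (1 / 2)
      simp only [hermiteGauss, Polynomial.hermite_zero, map_one, one_mul, Nat.factorial_zero,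
        Nat.cast_one, if_true]
      rw [show (2 * Real.pi) = Real.pi / (1 / 2) by ring, ← this]
      congr 1
      ext x
      congr 1
      ring
    | succ a =>
      have := integral_polynomial_mul_hermiteGauss_succ 1 a
      simp only [Polynomial.eval_one, one_mul, Polynomial.derivative_one, Polynomial.eval_zero,
        zero_mul, integral_zero] at this
      rw [if_neg (by omega), ← this]
      simp [hermiteGauss]
  | succ b ih =>
    have := integral_polynomial_mul_hermiteGauss_succ
      ((Polynomial.hermite a).map (algebraMap ℤ ℝ)) b
    simp only [eval_map_hermite] at this
    rw [this]
    cases a with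
    | zero => simp
    | succ a =>
      rw [Polynomial.derivative_map, derivative_hermite_succ]
      simp only [Polynomial.eval_map_algebraMap, map_mul, map_add, map_natCast,
        map_one]
      simp only [mul_assoc]
      rw [integral_const_mul, ih a]
      split_ifs with h1 h2 h2
      · rw [Nat.factorial_succ]; push_cast; ring
      · omega
      · omega
      · simp

/-! ### Hermite functions on `ℝⁿ` -/

/-- The constant `(2π)^{-n/2}`. -/
def maxwellConst (n : ℕ) : ℝ := (2 * Real.pi) ^ (-(n : ℝ) / 2)

theorem maxwellConst_pos (n : ℕ) : 0 < maxwellConst n :=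
  Real.rpow_pos_of_pos (by positivity) _

theorem maxwellian_pos {n : ℕ} (c : Space n) : 0 < maxwellian n c :=
  mul_pos (maxwellConst_pos n) (Real.exp_pos _)

theorem maxwellConst_mul_sqrt_pow (n : ℕ) :
    maxwellConst n * Real.sqrt (2 * Real.pi) ^ n = 1 := by
  rw [maxwellConst, Real.sqrt_eq_rpow, ← Real.rpow_natCast, ← Real.rpow_mul (by positivity),
    ← Real.rpow_add (by positivity)]
  rw [show -(n : ℝ) / 2 + 1 / 2 * n = 0 by ring, Real.rpow_zero]

theorem exp_neg_norm_sq {n : ℕ} (c : Space n) :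
    Real.exp (-‖c‖ ^ 2 / 2) = ∏ i, Real.exp (-(c i ^ 2 / 2)) := by
  rw [← Real.exp_sum, EuclideanSpace.norm_sq_eq]
  congr 1
  simp only [Real.norm_eq_abs, sq_abs, Finset.sum_neg_distrib]
  rw [neg_div, Finset.sum_div]

theorem maxwellian_eq_prod {n : ℕ} (c : Space n) :
    maxwellian n c = maxwellConst n * ∏ i, Real.exp (-(c i ^ 2 / 2)) := by
  rw [maxwellian, exp_neg_norm_sq, maxwellConst]

/-- The tensor product of one-dimensional Hermite functions. -/
def hermiteProd {n : ℕ} (α : Fin n → ℕ) (c : Space n) : ℝ :=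
  maxwellConst n * ∏ i, hermiteGauss (α i) (c i)

theorem hermiteProd_zero {n : ℕ} : hermiteProd (0 : Fin n → ℕ) = maxwellian n := by
  ext c
  simp [hermiteProd, maxwellian_eq_prod, hermiteGauss]

theorem negPartial_hermiteProd {n : ℕ} (i : Fin n) (α : Fin n → ℕ) :
    negPartial i (hermiteProd α) = hermiteProd (α + Pi.single i 1) := by
  ext c
  have hj : ∀ j ∈ (Finset.univ : Finset (Fin n)), HasFDerivAt
      (fun c : Space n => hermiteGauss (α j) (c j))
      ((-hermiteGauss (α j + 1) (c j)) • (EuclideanSpace.proj j : Space n →L[ℝ] ℝ)) c := by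
    intro j _
    exact (hasDerivAt_hermiteGauss (α j) (c j)).comp_hasFDerivAt c
      (EuclideanSpace.proj j : Space n →L[ℝ] ℝ).hasFDerivAt
  have h := (HasFDerivAt.finsetProd hj).const_mul (maxwellConst n)
  have h' : HasFDerivAt (hermiteProd α) _ c := h
  rw [negPartial, h'.fderiv]
  simp only [smul_apply, sum_apply, smul_eq_mul, PiLp.proj_apply, hermiteProd]
  rw [Finset.sum_eq_single i]
  · rw [← Finset.mul_prod_erase Finset.univ (fun j => hermiteGauss _ (c j)) (Finset.mem_univ i)]
    have : ∏ j ∈ Finset.univ.erase i, hermiteGauss ((α + Pi.single i 1 : Fin n → ℕ) j) (c j) =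
        ∏ j ∈ Finset.univ.erase i, hermiteGauss (α j) (c j) := by
      apply Finset.prod_congr rfl
      intro j hj
      simp [Finset.ne_of_mem_erase hj]
    rw [this]
    simp [mul_comm]
  · intro j _ hj
    simp [hj]
  · simp

theorem negPartial_iterate_hermiteProd {n : ℕ} (i : Fin n) (α : Fin n → ℕ) (k : ℕ) :
    (negPartial i)^[k] (hermiteProd α) = hermiteProd (α + Pi.single i k) := by
  induction k with
  | zero => simp
  | succ k ih =>
    rw [Function.iterate_succ_apply', ih, negPartial_hermiteProd, add_assoc, ← Pi.single_add]

theorem hermiteFn_eq_hermiteProd {n : ℕ} (α : Fin n → ℕ) : hermiteFn α = hermiteProd α := by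
  have key : ∀ l : List (Fin n),
      l.foldr (fun i h => (negPartial i)^[α i] h) (maxwellian n) =
        hermiteProd (l.map fun i => Pi.single i (α i)).sum := by
    intro l
    induction l with
    | nil => simp [hermiteProd_zero]
    | cons i l ih =>
      rw [List.foldr_cons, ih, negPartial_iterate_hermiteProd, List.map_cons, List.sum_cons,
        add_comm]
  rw [hermiteFn, negDeriv, key]
  congr 1
  rw [← List.ofFn_eq_map, List.sum_ofFn, Finset.univ_sum_single]

theorem continuous_hermiteGauss (k : ℕ) : Continuous (hermiteGauss k) :=
  continuous_iff_continuousAt.2 fun x => (hasDerivAt_hermiteGauss k x).continuousAt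

theorem continuous_hermiteFn {n : ℕ} (α : Fin n → ℕ) : Continuous (hermiteFn α) := by
  rw [hermiteFn_eq_hermiteProd]
  refine continuous_const.mul (continuous_finsetProd _ fun i _ => ?_)
  exact (continuous_hermiteGauss _).comp (EuclideanSpace.proj i : Space n →L[ℝ] ℝ).continuous

theorem continuous_maxwellian (n : ℕ) : Continuous (maxwellian n) := by
  unfold maxwellian; fun_prop

/-- The weight cancels the Gaussian and the constant of one factor, so what remains is a product of
one-dimensional integrands. -/
theorem hermiteFn_mul_hermiteFn_div {n : ℕ} (α β : Fin n → ℕ) (c : Space n) :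
    1 / maxwellian n c * (hermiteFn α c * hermiteFn β c) =
      maxwellConst n *
        ∏ i, (Polynomial.aeval (c i) (Polynomial.hermite (α i)) * hermiteGauss (β i) (c i)) := by
  rw [hermiteFn_eq_hermiteProd, hermiteFn_eq_hermiteProd, maxwellian_eq_prod, hermiteProd,
    hermiteProd]
  have h1 := (maxwellConst_pos n).ne'
  have h2 : (∏ i, Real.exp (-(c i ^ 2 / 2))) ≠ 0 := (Finset.prod_pos fun i _ => Real.exp_pos _).ne'
  simp only [hermiteGauss, Finset.prod_mul_distrib]
  field_simp

theorem integrable_hermiteFn_mul_div {n : ℕ} (α β : Fin n → ℕ) :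
    Integrable fun c : Space n => 1 / maxwellian n c * (hermiteFn α c * hermiteFn β c) := by
  simp only [hermiteFn_mul_hermiteFn_div]
  refine Integrable.const_mul ?_ _
  have h := (EuclideanSpace.volume_preserving_symm_measurableEquiv_toLp (Fin n))
  have h2 : Integrable (fun x : Fin n → ℝ =>
      ∏ i, (Polynomial.aeval (x i) (Polynomial.hermite (α i)) * hermiteGauss (β i) (x i))) := by
    refine Integrable.fintype_prod (f := fun i x =>
      Polynomial.aeval x (Polynomial.hermite (α i)) * hermiteGauss (β i) x) fun i => ?_
    simpa only [eval_map_hermite] using integrable_polynomial_mul_hermiteGauss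
      ((Polynomial.hermite (α i)).map (algebraMap ℤ ℝ)) (β i)
  exact (h.integrable_comp_emb (MeasurableEquiv.measurableEmbedding _)).2 h2

theorem integral_hermiteFn_mul_div {n : ℕ} (α β : Fin n → ℕ) :
    ∫ c : Space n, 1 / maxwellian n c * (hermiteFn α c * hermiteFn β c) =
      if α = β then ((∏ i, (α i).factorial : ℕ) : ℝ) else 0 := by
  simp only [hermiteFn_mul_hermiteFn_div]
  rw [integral_const_mul]
  have h := (EuclideanSpace.volume_preserving_symm_measurableEquiv_toLp (Fin n))
  have h3 := h.integral_comp (MeasurableEquiv.measurableEmbedding _) (fun x : Fin n → ℝ =>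
      ∏ i, (Polynomial.aeval (x i) (Polynomial.hermite (α i)) * hermiteGauss (β i) (x i)))
  have h4 := integral_fintype_prod_volume_eq_prod (fun (i : Fin n) (x : ℝ) =>
      Polynomial.aeval x (Polynomial.hermite (α i)) * hermiteGauss (β i) x)
  rw [h4] at h3
  refine (congrArg _ h3).trans ?_
  simp only [integral_hermite_mul_hermiteGauss]
  split_ifs with hab
  · subst hab
    simp only [if_true, Finset.prod_mul_distrib, Finset.prod_const, Finset.card_univ,
      Fintype.card_fin]
    rw [mul_left_comm, maxwellConst_mul_sqrt_pow]
    simp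
  · obtain ⟨i, hi⟩ := Function.ne_iff.1 hab
    rw [Finset.prod_eq_zero (Finset.mem_univ i) (if_neg hi), mul_zero]

/-! ### The Hermite basis of the weighted space -/

theorem measurable_velDensity (n : ℕ) :
    Measurable fun c : Space n => ENNReal.ofReal (1 / maxwellian n c) :=
  (measurable_const.div (continuous_maxwellian n).measurable).ennreal_ofReal

theorem integral_velMeasure {n : ℕ} (f : Space n → ℂ) :
    ∫ c, f c ∂(velMeasure n) = ∫ c, (1 / maxwellian n c : ℝ) • f c := by
  rw [velMeasure, integral_withDensity_eq_integral_toReal_smul (measurable_velDensity n)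
    (ae_of_all _ fun _ => ENNReal.ofReal_lt_top)]
  refine integral_congr_ae (ae_of_all _ fun c => ?_)
  simp only
  rw [ENNReal.toReal_ofReal (one_div_pos.2 (maxwellian_pos c)).le]

theorem memLp_hermiteFn {n : ℕ} (α : Fin n → ℕ) :
    MemLp (fun c => (hermiteFn α c : ℂ)) 2 (velMeasure n) := by
  have hm : AEStronglyMeasurable (fun c => (hermiteFn α c : ℂ)) (velMeasure n) :=
    (Complex.continuous_ofReal.comp (continuous_hermiteFn α)).aestronglyMeasurable
  rw [memLp_two_iff_integrable_sq_norm hm, velMeasure,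
    integrable_withDensity_iff (measurable_velDensity n)
      (ae_of_all _ fun _ => ENNReal.ofReal_lt_top)]
  refine (integrable_hermiteFn_mul_div α α).congr (ae_of_all _ fun c => ?_)
  simp only
  rw [ENNReal.toReal_ofReal (one_div_pos.2 (maxwellian_pos c)).le, Complex.norm_real,
    Real.norm_eq_abs, sq_abs]
  ring

/-- The Hermite function `ψ^α` as an element of `L²_w`. -/
def hermiteLp {n : ℕ} (α : Fin n → ℕ) : L2w n := (memLp_hermiteFn α).toLp _

theorem coeFn_hermiteLp {n : ℕ} (α : Fin n → ℕ) :
    hermiteLp α =ᵐ[velMeasure n] fun c => (hermiteFn α c : ℂ) := MemLp.coeFn_toLp _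

theorem inner_hermiteLp {n : ℕ} (α : Fin n → ℕ) (f : L2w n) :
    inner ℂ (hermiteLp α) f = moment α f := by
  rw [L2.inner_def, moment]
  refine integral_congr_ae ?_
  filter_upwards [coeFn_hermiteLp α] with c hc
  rw [hc]
  simp

/-- The product of factorials `α!`. -/
def multiFactorial {n : ℕ} (α : Fin n → ℕ) : ℝ := ((∏ i, (α i).factorial : ℕ) : ℝ)

theorem multiFactorial_pos {n : ℕ} (α : Fin n → ℕ) : 0 < multiFactorial α :=
  Nat.cast_pos.2 (Finset.prod_pos fun _ _ => Nat.factorial_pos _)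

theorem inner_hermiteLp_hermiteLp {n : ℕ} (α β : Fin n → ℕ) :
    inner ℂ (hermiteLp α) (hermiteLp β) = if α = β then (multiFactorial α : ℂ) else 0 := by
  rw [inner_hermiteLp, moment]
  have h1 : ∫ c, hermiteLp β c * (hermiteFn α c : ℂ) ∂(velMeasure n) =
      ∫ c, ((hermiteFn α c * hermiteFn β c : ℝ) : ℂ) ∂(velMeasure n) := by
    refine integral_congr_ae ?_
    filter_upwards [coeFn_hermiteLp β] with c hc
    rw [hc]
    push_cast
    ring
  rw [h1, integral_velMeasure]
  have h2 : ∀ c : Space n, (1 / maxwellian n c : ℝ) • ((hermiteFn α c * hermiteFn β c : ℝ) : ℂ) =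
      ((1 / maxwellian n c * (hermiteFn α c * hermiteFn β c) : ℝ) : ℂ) := by
    intro c
    rw [Complex.real_smul, ← Complex.ofReal_mul]
  simp only [h2]
  rw [integral_complex_ofReal, integral_hermiteFn_mul_div]
  split_ifs <;> simp [multiFactorial]

/-- The normalised Hermite functions `ψ^α / √α!`. -/
def hermiteUnit {n N : ℕ} (α : MultiIdx n N) : L2w n :=
  ((Real.sqrt (multiFactorial α.1))⁻¹ : ℂ) • hermiteLp α.1

theorem ofReal_sqrt_mul_self {x : ℝ} (hx : 0 ≤ x) : (Real.sqrt x : ℂ) * Real.sqrt x = x := by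
  rw [← Complex.ofReal_mul, Real.mul_self_sqrt hx]

theorem ofReal_sqrt_ne_zero {x : ℝ} (hx : 0 < x) : (Real.sqrt x : ℂ) ≠ 0 :=
  Complex.ofReal_ne_zero.2 (Real.sqrt_pos.2 hx).ne'

theorem orthonormal_hermiteUnit (n N : ℕ) :
    Orthonormal ℂ (hermiteUnit : MultiIdx n N → L2w n) := by
  rw [orthonormal_iff_ite]
  intro α β
  rw [hermiteUnit, hermiteUnit, inner_smul_left, inner_smul_right, inner_hermiteLp_hermiteLp]
  by_cases h : α = β
  · subst h
    simp only [if_true, map_inv₀, Complex.conj_ofReal]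
    rw [← ofReal_sqrt_mul_self (multiFactorial_pos α.1).le]
    have := ofReal_sqrt_ne_zero (multiFactorial_pos α.1)
    field_simp
  · rw [if_neg h, if_neg (fun h' => h (Subtype.ext h'))]
    simp

/-- The squared norm `∑_β |y_β|² / β!` on vectors of moments. -/
def weightSq {n N : ℕ} (y : MultiIdx n N → ℂ) : ℝ := ∑ β, ‖y β‖ ^ 2 / multiFactorial β.1

/-- The vector `(y_β / √β!)_β`, whose Euclidean norm squared is `weightSq y`. -/
def weightVec {n N : ℕ} (y : MultiIdx n N → ℂ) : EuclideanSpace ℂ (MultiIdx n N) :=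
  WithLp.toLp 2 fun β => ((Real.sqrt (multiFactorial β.1))⁻¹ : ℂ) * y β

theorem norm_weightVec_sq {n N : ℕ} (y : MultiIdx n N → ℂ) : ‖weightVec y‖ ^ 2 = weightSq y := by
  rw [EuclideanSpace.norm_sq_eq, weightSq]
  refine Finset.sum_congr rfl fun β _ => ?_
  rw [weightVec]
  simp only [norm_mul, norm_inv, Complex.norm_real, Real.norm_eq_abs, mul_pow, inv_pow, sq_abs]
  rw [Real.sq_sqrt (multiFactorial_pos β.1).le]
  field_simp

theorem norm_weightVec {n N : ℕ} (y : MultiIdx n N → ℂ) :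
    ‖weightVec y‖ = Real.sqrt (weightSq y) := by
  rw [← norm_weightVec_sq, Real.sqrt_sq (norm_nonneg _)]

/-- Bessel's inequality for the moments. -/
theorem weightSq_moment_le {n N : ℕ} (f : L2w n) :
    weightSq (fun β : MultiIdx n N => moment β.1 f) ≤ ‖f‖ ^ 2 := by
  refine le_trans (le_of_eq ?_)
    ((orthonormal_hermiteUnit n N).sum_inner_products_le f (s := Finset.univ))
  rw [weightSq]
  refine Finset.sum_congr rfl fun β _ => ?_
  rw [hermiteUnit, inner_smul_left, inner_hermiteLp]
  simp only [norm_mul, map_inv₀, Complex.conj_ofReal, norm_inv, Complex.norm_real,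
    Real.norm_eq_abs, mul_pow, inv_pow, sq_abs]
  rw [Real.sq_sqrt (multiFactorial_pos β.1).le]
  field_simp

/-- Parseval's identity for finite Hermite expansions. -/
theorem eLpNorm_hermite_sum {n N : ℕ} (y : MultiIdx n N → ℂ) :
    eLpNorm (fun c => ∑ α : MultiIdx n N,
      (1 / ((∏ i, (α.1 i).factorial : ℕ) : ℂ)) * y α * (hermiteFn α.1 c : ℂ)) 2 (velMeasure n) =
      ENNReal.ofReal ‖weightVec y‖ := by
  have h1 : (∑ α : MultiIdx n N, (weightVec y α) • (hermiteUnit α : L2w n) : L2w n)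
      =ᵐ[velMeasure n] fun c => ∑ α : MultiIdx n N,
      (1 / ((∏ i, (α.1 i).factorial : ℕ) : ℂ)) * y α * (hermiteFn α.1 c : ℂ) := by
    have h2 : ∀ᵐ c ∂(velMeasure n), ∀ α : MultiIdx n N,
        ((weightVec y α) • (hermiteUnit α : L2w n) : L2w n) c =
        (1 / ((∏ i, (α.1 i).factorial : ℕ) : ℂ)) * y α * (hermiteFn α.1 c : ℂ) := by
      rw [ae_all_iff]
      intro α
      rw [hermiteUnit, smul_smul]
      filter_upwards [Lp.coeFn_smul (weightVec y α * ((Real.sqrt (multiFactorial α.1))⁻¹ : ℂ))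
        (hermiteLp α.1), coeFn_hermiteLp α.1] with c h3 h4
      rw [h3, Pi.smul_apply, h4, smul_eq_mul]
      congr 1
      have h5 := ofReal_sqrt_ne_zero (multiFactorial_pos α.1)
      have h6 : ((∏ i, (α.1 i).factorial : ℕ) : ℂ) =
          (Real.sqrt (multiFactorial α.1) : ℂ) * Real.sqrt (multiFactorial α.1) := by
        rw [ofReal_sqrt_mul_self (multiFactorial_pos α.1).le, multiFactorial]
        simp
      rw [h6, weightVec]
      field_simp
    filter_upwards [h2, Lp.coeFn_finsetSum Finset.univ
      (fun α : MultiIdx n N => (weightVec y α) • (hermiteUnit α : L2w n))] with c h3 h4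
    rw [h4]
    simp [h3]
  rw [← eLpNorm_congr_ae h1, ← Lp.enorm_def, ← ofReal_norm]
  congr 1
  rw [← sq_eq_sq₀ (norm_nonneg _) (norm_nonneg _), EuclideanSpace.norm_sq_eq]
  have h7 := (orthonormal_hermiteUnit n N).inner_sum (fun α => weightVec y α)
    (fun α => weightVec y α) Finset.univ
  rw [← inner_self_eq_norm_sq (𝕜 := ℂ), h7]
  simp [Complex.sq_norm, Complex.normSq_apply]

/-- The density `exp(-|c|²/2)` is at most 1 and `1/ψ^0` is at least 1. The second bound of the
theorem therefore follows from the first. -/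
theorem gaussMeasure_le_velMeasure (n : ℕ) : gaussMeasure n ≤ velMeasure n := by
  refine withDensity_mono (ae_of_all _ fun c => ENNReal.ofReal_le_ofReal ?_)
  have h1 : Real.exp (-‖c‖ ^ 2 / 2) ≤ 1 := Real.exp_le_one_iff.2 (by nlinarith [sq_nonneg ‖c‖])
  have h2 : maxwellConst n ≤ 1 := by
    refine Real.rpow_le_one_of_one_le_of_nonpos (by nlinarith [Real.pi_gt_three]) ?_
    have : (0 : ℝ) ≤ n := n.cast_nonneg
    linarith
  have h3 : maxwellian n c ≤ 1 :=
    mul_le_one₀ h2 (Real.exp_pos _).le h1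
  exact h1.trans ((one_le_div (maxwellian_pos c)).2 h3)

/-- A bound on the weighted norm of the moments controls the mixed norms of the expansion. -/
theorem mixedNorm_galerkinApprox_le {n N : ℕ}
    {m : ℝ → MultiIdx n N → Lp ℂ 2 (volume : Measure (Space n))} {t K : ℝ}
    (h : ∀ᵐ x, ‖weightVec fun α => m t α x‖ ≤ K) :
    mixedNorm (velMeasure n) (galerkinApprox m t) ≤ ENNReal.ofReal K ∧
      mixedNorm (gaussMeasure n) (galerkinApprox m t) ≤ ENNReal.ofReal K := by
  have h1 : ∀ᵐ x, eLpNorm (galerkinApprox m t x) 2 (velMeasure n) ≤ ENNReal.ofReal K := by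
    filter_upwards [h] with x hx
    exact (eLpNorm_hermite_sum fun α => m t α x).le.trans (ENNReal.ofReal_le_ofReal hx)
  refine ⟨essSup_le_of_ae_le _ h1, essSup_le_of_ae_le _ ?_⟩
  filter_upwards [h1] with x hx
  exact (eLpNorm_mono_measure _ (gaussMeasure_le_velMeasure n)).trans hx

/-! ### Decay of the Fourier modes, uniformly in `N` -/

/-- The matrix `i ∑_j k_j A_j + B` governing the Fourier mode of frequency `k`. -/
def symbolMatrix (n N : ℕ) (k : Space n) : Matrix (MultiIdx n N) (MultiIdx n N) ℂ :=
  ∑ j, (Complex.I * (k j : ℂ)) • transportMatrix n N j + collisionMatrix n N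

/-- The vector of moments, extended by zero to all multi-indices. -/
def extendZero {n N : ℕ} (y : MultiIdx n N → ℂ) (α : Fin n → ℕ) : ℂ :=
  if h : ∑ i, α i ≤ N then y ⟨α, h⟩ else 0

theorem sum_eq_extendZero {n N : ℕ} (y : MultiIdx n N → ℂ) (β : Fin n → ℕ) :
    (∑ α : MultiIdx n N, if α.1 = β then y α else 0) = extendZero y β := by
  rw [extendZero]
  split_ifs with h
  · rw [Finset.sum_eq_single ⟨β, h⟩]
    · simp
    · intro α _ hα
      exact if_neg fun h' => hα (Subtype.ext h')
    · simp
  · refine Finset.sum_eq_zero fun α _ => if_neg fun h' => h ?_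
    rw [← h']
    exact α.2

theorem transportMatrix_apply {n N : ℕ} (j : Fin n) (β α : MultiIdx n N) :
    transportMatrix n N j β α = (if α.1 + Pi.single j 1 = β.1 then (β.1 j : ℂ) else 0) +
      if α.1 = β.1 + Pi.single j 1 then 1 else 0 := by
  rw [transportMatrix, Matrix.of_apply]
  by_cases h1 : α.1 + Pi.single j 1 = β.1
  · have h2 : ¬ α.1 = β.1 + Pi.single j 1 := by
      intro h2
      have h3 := congrFun h1 j
      have h4 := congrFun h2 j
      simp at h3 h4
      omega
    simp [h1, h2]
  · simp [h1]

theorem transportMatrix_mulVec {n N : ℕ} (j : Fin n) (y : MultiIdx n N → ℂ) (β : MultiIdx n N) :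
    (transportMatrix n N j).mulVec y β =
      (∑ α : MultiIdx n N, if α.1 + Pi.single j 1 = β.1 then (β.1 j : ℂ) * y α else 0) +
        extendZero y (β.1 + Pi.single j 1) := by
  rw [Matrix.mulVec, dotProduct, ← sum_eq_extendZero, ← Finset.sum_add_distrib]
  refine Finset.sum_congr rfl fun α _ => ?_
  rw [transportMatrix_apply, add_mul, ite_mul, ite_mul, zero_mul, one_mul]

theorem multiFactorial_add_single {n : ℕ} (α : Fin n → ℕ) (j : Fin n) :
    multiFactorial (α + Pi.single j 1) = (α j + 1) * multiFactorial α := by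
  rw [multiFactorial, multiFactorial]
  rw [← Finset.mul_prod_erase Finset.univ _ (Finset.mem_univ j),
    ← Finset.mul_prod_erase Finset.univ (fun i => (α i).factorial) (Finset.mem_univ j)]
  have : ∏ i ∈ Finset.univ.erase j, ((α + Pi.single j 1 : Fin n → ℕ) i).factorial =
      ∏ i ∈ Finset.univ.erase j, (α i).factorial := by
    refine Finset.prod_congr rfl fun i hi => ?_
    simp [Finset.ne_of_mem_erase hi]
  rw [this]
  simp [Nat.factorial_succ, mul_assoc]

/-- `A_j` is symmetric with respect to the weights `1/β!`. -/
theorem transportMatrix_symm {n N : ℕ} (j : Fin n) (β α : MultiIdx n N) :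
    transportMatrix n N j β α / (multiFactorial β.1 : ℂ) =
      transportMatrix n N j α β / (multiFactorial α.1 : ℂ) := by
  have key : ∀ β α : MultiIdx n N, α.1 + Pi.single j 1 = β.1 →
      (β.1 j : ℂ) / (multiFactorial β.1 : ℂ) = 1 / (multiFactorial α.1 : ℂ) := by
    intro β α h
    rw [← h, multiFactorial_add_single]
    have h1 : (multiFactorial α.1 : ℂ) ≠ 0 :=
      Complex.ofReal_ne_zero.2 (multiFactorial_pos α.1).ne'
    have h2 : ((α.1 j : ℂ) + 1) ≠ 0 := Nat.cast_add_one_ne_zero _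
    simp
    field_simp
  rw [transportMatrix_apply, transportMatrix_apply, add_div, add_div, add_comm]
  congr 1
  · by_cases h : α.1 = β.1 + Pi.single j 1
    · rw [if_pos h, if_pos h.symm, key α β h.symm]
    · rw [if_neg h, if_neg (Ne.symm h), zero_div, zero_div]
  · by_cases h : α.1 + Pi.single j 1 = β.1
    · rw [if_pos h, if_pos h.symm, key β α h]
    · rw [if_neg h, if_neg (Ne.symm h), zero_div, zero_div]

/-- A real matrix that is symmetric for the weights has a real quadratic form, so transport, which
carries a factor `i`, does not change the energy. -/
theorem im_sum_transportMatrix {n N : ℕ} (j : Fin n) (y : MultiIdx n N → ℂ) :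
    (∑ β, (starRingEnd ℂ (y β)) * (transportMatrix n N j).mulVec y β /
      (multiFactorial β.1 : ℂ)).im = 0 := by
  rw [← Complex.conj_eq_iff_im]
  have h1 : ∀ β, (starRingEnd ℂ (y β)) * (transportMatrix n N j).mulVec y β /
      (multiFactorial β.1 : ℂ) = ∑ α, (starRingEnd ℂ (y β)) *
        (transportMatrix n N j β α / (multiFactorial β.1 : ℂ)) * y α := by
    intro β
    rw [Matrix.mulVec, dotProduct, Finset.mul_sum, Finset.sum_div]
    exact Finset.sum_congr rfl fun α _ => by ring
  have h2 : ∀ β α, starRingEnd ℂ (transportMatrix n N j β α) = transportMatrix n N j β α := by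
    intro β α
    rw [transportMatrix, Matrix.of_apply]
    split_ifs <;> simp
  simp only [h1, map_sum, map_mul, map_div₀, h2, Complex.conj_conj, Complex.conj_ofReal]
  rw [Finset.sum_comm]
  refine Finset.sum_congr rfl fun β _ => Finset.sum_congr rfl fun α _ => ?_
  rw [transportMatrix_symm]
  ring

theorem symbolMatrix_mulVec {n N : ℕ} (k : Space n) (y : MultiIdx n N → ℂ) (β : MultiIdx n N) :
    (symbolMatrix n N k).mulVec y β =
      Complex.I * ∑ j, (k j : ℂ) * (transportMatrix n N j).mulVec y β +
        ((∑ i, β.1 i : ℕ) : ℂ) * y β := by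
  rw [symbolMatrix, Matrix.add_mulVec, Pi.add_apply, collisionMatrix, Matrix.mulVec_diagonal,
    Matrix.sum_mulVec, Finset.sum_apply, Finset.mul_sum]
  congr 1
  refine Finset.sum_congr rfl fun j _ => ?_
  rw [Matrix.smul_mulVec, Pi.smul_apply, smul_eq_mul, mul_assoc]

/-- The dissipation identity for the weighted norm. -/
theorem sum_inner_symbolMatrix {n N : ℕ} (k : Space n) (y : MultiIdx n N → ℂ) :
    ∑ β, inner ℝ (y β) ((symbolMatrix n N k).mulVec y β) / multiFactorial β.1 =
      ∑ β, ((∑ i, β.1 i : ℕ) : ℝ) * (‖y β‖ ^ 2 / multiFactorial β.1) := by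
  have h1 : ∀ β, inner ℝ (y β) ((symbolMatrix n N k).mulVec y β) / multiFactorial β.1 =
      (Complex.I * ∑ j, (k j : ℂ) * ((starRingEnd ℂ (y β)) *
        (transportMatrix n N j).mulVec y β / (multiFactorial β.1 : ℂ))).re +
      ((∑ i, β.1 i : ℕ) : ℝ) * (‖y β‖ ^ 2 / multiFactorial β.1) := by
    intro β
    have e : (inner ℝ (y β) ((symbolMatrix n N k).mulVec y β) : ℝ) =
        (starRingEnd ℂ (y β) * (symbolMatrix n N k).mulVec y β).re := by
      rw [Complex.inner, mul_comm]
    rw [e, symbolMatrix_mulVec, mul_add, Complex.add_re, add_div]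
    congr 1
    · rw [← Complex.div_ofReal_re]
      congr 1
      rw [mul_left_comm, mul_div_assoc, Finset.mul_sum, Finset.sum_div]
      congr 1
      exact Finset.sum_congr rfl fun j _ => by ring
    · rw [mul_left_comm, Complex.conj_mul']
      norm_cast
      ring
  simp only [h1]
  rw [Finset.sum_add_distrib, add_eq_right, ← Complex.re_sum, ← Finset.mul_sum, Finset.sum_comm]
  simp only [← Finset.mul_sum]
  rw [Complex.I_mul_re, Complex.im_sum, neg_eq_zero]
  refine Finset.sum_eq_zero fun j _ => ?_
  rw [Complex.im_ofReal_mul, im_sum_transportMatrix, mul_zero]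

/-- The multi-index `0`. -/
def zeroIdx (n N : ℕ) : MultiIdx n N := ⟨0, by simp⟩

theorem extendZero_val {n N : ℕ} (y : MultiIdx n N → ℂ) (α : MultiIdx n N) :
    extendZero y α.1 = y α := dif_pos α.2

/-- The component `∑_j k_j m_{e_j}` of the momentum along `k`. -/
def momentum {n N : ℕ} (k : Space n) (y : MultiIdx n N → ℂ) : ℂ :=
  ∑ j, (k j : ℂ) * extendZero y (Pi.single j 1)

/-- The component `∑_{l,j} k_l k_j m_{e_l + e_j}` of the second moments along `k`. -/
def stress {n N : ℕ} (k : Space n) (y : MultiIdx n N → ℂ) : ℂ :=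
  ∑ l, (k l : ℂ) * ∑ j, (k j : ℂ) * extendZero y (Pi.single l 1 + Pi.single j 1)

/-- Conservation of mass: collisions have eigenvalue `0` at the index `0`, and no lower index
exists. -/
theorem symbolMatrix_mulVec_zeroIdx {n N : ℕ} (k : Space n) (y : MultiIdx n N → ℂ) :
    (symbolMatrix n N k).mulVec y (zeroIdx n N) = Complex.I * momentum k y := by
  rw [symbolMatrix_mulVec, momentum]
  simp only [transportMatrix_mulVec]
  simp [zeroIdx]

/-- The row `e_l` belongs to the system only when `N ≥ 1`. For `N = 1` the second moments are zero
by extension, so this case needs no separate treatment. -/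
theorem extendZero_symbolMatrix_single {n N : ℕ} (hN : 1 ≤ N) (k : Space n)
    (y : MultiIdx n N → ℂ) (l : Fin n) :
    extendZero ((symbolMatrix n N k).mulVec y) (Pi.single l 1) =
      Complex.I * ((k l : ℂ) * y (zeroIdx n N) +
        ∑ j, (k j : ℂ) * extendZero y (Pi.single l 1 + Pi.single j 1)) +
        extendZero y (Pi.single l 1) := by
  have hl : ∑ i, (Pi.single l 1 : Fin n → ℕ) i ≤ N := by simpa using hN
  rw [show (Pi.single l 1 : Fin n → ℕ) = (⟨Pi.single l 1, hl⟩ : MultiIdx n N).1 from rfl,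
    extendZero_val, symbolMatrix_mulVec, extendZero_val]
  simp only [transportMatrix_mulVec, mul_add, Finset.sum_add_distrib]
  have h2 : ∀ j : Fin n, (∑ α : MultiIdx n N, if α.1 + Pi.single j 1 = (Pi.single l 1 : Fin n → ℕ)
      then (((Pi.single l 1 : Fin n → ℕ) j : ℕ) : ℂ) * y α else 0) =
      if j = l then y (zeroIdx n N) else 0 := by
    intro j
    split_ifs with h
    · subst h
      rw [Finset.sum_eq_single (zeroIdx n N)]
      · simp [zeroIdx]
      · intro α _ hα
        refine if_neg fun h' => hα (Subtype.ext ?_)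
        simpa [zeroIdx] using h'
      · simp
    · refine Finset.sum_eq_zero fun α _ => ?_
      simp [h]
  simp only [h2]
  simp

/-- The term `|k|² y_0` is what couples the undamped mass to the damped momentum. -/
theorem momentum_symbolMatrix {n N : ℕ} (hN : 1 ≤ N) (k : Space n) (y : MultiIdx n N → ℂ) :
    momentum k ((symbolMatrix n N k).mulVec y) =
      Complex.I * ((‖k‖ ^ 2 : ℝ) * y (zeroIdx n N) + stress k y) + momentum k y := by
  rw [momentum, momentum, stress]
  simp only [extendZero_symbolMatrix_single hN]
  rw [EuclideanSpace.norm_sq_eq]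
  simp only [mul_add, Finset.sum_add_distrib, Complex.ofReal_sum, Finset.sum_mul, Finset.mul_sum]
  congr 2
  · refine Finset.sum_congr rfl fun l _ => ?_
    simp only [Real.norm_eq_abs, sq_abs, Complex.ofReal_pow]
    ring
  · refine Finset.sum_congr rfl fun l _ => Finset.sum_congr rfl fun j _ => ?_
    ring

/-- The weighted norm squared of the moments of positive order. -/
def fluctSq {n N : ℕ} (y : MultiIdx n N → ℂ) : ℝ :=
  ∑ β ∈ Finset.univ.erase (zeroIdx n N), ‖y β‖ ^ 2 / multiFactorial β.1

theorem fluctSq_nonneg {n N : ℕ} (y : MultiIdx n N → ℂ) : 0 ≤ fluctSq y :=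
  Finset.sum_nonneg fun β _ => div_nonneg (sq_nonneg _) (multiFactorial_pos β.1).le

theorem weightSq_eq {n N : ℕ} (y : MultiIdx n N → ℂ) :
    weightSq y = ‖y (zeroIdx n N)‖ ^ 2 + fluctSq y := by
  rw [weightSq, fluctSq, ← Finset.add_sum_erase Finset.univ _ (Finset.mem_univ (zeroIdx n N))]
  simp [zeroIdx, multiFactorial]

/-- Every index other than `0` has `|β| ≥ 1`: a spectral gap independent of `N`. -/
theorem fluctSq_le_dissipation {n N : ℕ} (y : MultiIdx n N → ℂ) :
    fluctSq y ≤ ∑ β, ((∑ i, β.1 i : ℕ) : ℝ) * (‖y β‖ ^ 2 / multiFactorial β.1) := by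
  rw [fluctSq, ← Finset.add_sum_erase Finset.univ (fun β : MultiIdx n N =>
    ((∑ i, β.1 i : ℕ) : ℝ) * (‖y β‖ ^ 2 / multiFactorial β.1)) (Finset.mem_univ (zeroIdx n N))]
  refine le_add_of_nonneg_of_le (by simp [zeroIdx]) (Finset.sum_le_sum fun β hβ => ?_)
  refine le_mul_of_one_le_left (div_nonneg (sq_nonneg _) (multiFactorial_pos β.1).le) ?_
  rw [Nat.one_le_cast, Nat.one_le_iff_ne_zero]
  intro h
  refine Finset.ne_of_mem_erase hβ (Subtype.ext (funext fun i => ?_))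
  simpa [zeroIdx] using (Finset.sum_eq_zero_iff.1 h) i (Finset.mem_univ i)

/-- The factor `α!` is harmless, because this is applied only to indices of order one and two. -/
theorem norm_extendZero_sq_le {n N : ℕ} (y : MultiIdx n N → ℂ) (α : Fin n → ℕ) (hα : α ≠ 0) :
    ‖extendZero y α‖ ^ 2 ≤ multiFactorial α * fluctSq y := by
  have hf := multiFactorial_pos α
  rw [extendZero]
  split_ifs with h
  · rw [← div_le_iff₀' hf]
    exact Finset.single_le_sum (f := fun β : MultiIdx n N => ‖y β‖ ^ 2 / multiFactorial β.1)
      (fun β _ => div_nonneg (sq_nonneg _) (multiFactorial_pos β.1).le)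
      (Finset.mem_erase.2 ⟨fun h' => hα (congrArg Subtype.val h'), Finset.mem_univ _⟩)
  · simpa using mul_nonneg hf.le (fluctSq_nonneg y)

theorem norm_momentum_le {n N : ℕ} (k : Space n) (y : MultiIdx n N → ℂ) :
    ‖momentum k y‖ ≤ n * ‖k‖ * Real.sqrt (fluctSq y) := by
  have h1 : ∀ j : Fin n, ‖(k j : ℂ) * extendZero y (Pi.single j 1)‖ ≤
      ‖k‖ * Real.sqrt (fluctSq y) := by
    intro j
    rw [norm_mul, Complex.norm_real]
    refine mul_le_mul (PiLp.norm_apply_le k j) (Real.le_sqrt_of_sq_le ?_) (norm_nonneg _)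
      (norm_nonneg _)
    have h2 := norm_extendZero_sq_le y (Pi.single j 1) (by simp)
    have h3 := multiFactorial_add_single (0 : Fin n → ℕ) j
    rw [zero_add] at h3
    rw [h3] at h2
    simpa [multiFactorial] using h2
  refine (norm_sum_le_of_le _ fun j _ => h1 j).trans (le_of_eq ?_)
  simp [mul_assoc]

theorem norm_stress_le {n N : ℕ} (k : Space n) (y : MultiIdx n N → ℂ) :
    ‖stress k y‖ ≤ 2 * n ^ 2 * ‖k‖ ^ 2 * Real.sqrt (fluctSq y) := by
  have h1 : ∀ l j : Fin n, ‖(k j : ℂ) * extendZero y (Pi.single l 1 + Pi.single j 1)‖ ≤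
      ‖k‖ * (2 * Real.sqrt (fluctSq y)) := by
    intro l j
    rw [norm_mul, Complex.norm_real]
    refine mul_le_mul (PiLp.norm_apply_le k j) ?_ (norm_nonneg _) (norm_nonneg _)
    refine abs_le_of_sq_le_sq' ?_ (by positivity) |>.2
    have h2 := norm_extendZero_sq_le y (Pi.single l 1 + Pi.single j 1) (by
      intro h
      have := congrFun h j
      simp at this)
    have h3 := multiFactorial_add_single (0 : Fin n → ℕ) l
    have h4 := multiFactorial_add_single (Pi.single l 1 : Fin n → ℕ) j
    rw [zero_add] at h3
    rw [h4, h3] at h2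
    refine h2.trans ?_
    rw [mul_pow, Real.sq_sqrt (fluctSq_nonneg y)]
    refine mul_le_mul_of_nonneg_right ?_ (fluctSq_nonneg y)
    -- This gives `(e_l + e_j)! ≤ 2`, the extreme case being `l = j`.
    have h5 : ((Pi.single l 1 : Fin n → ℕ) j : ℝ) ≤ 1 := by
      rw [Pi.single_apply]
      split_ifs <;> simp
    simp [multiFactorial]
    linarith
  have h2 : ∀ l : Fin n, ‖(k l : ℂ) *
      ∑ j, (k j : ℂ) * extendZero y (Pi.single l 1 + Pi.single j 1)‖ ≤
      ‖k‖ * (n * (‖k‖ * (2 * Real.sqrt (fluctSq y)))) := by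
    intro l
    rw [norm_mul, Complex.norm_real]
    refine mul_le_mul (PiLp.norm_apply_le k l) ?_ (norm_nonneg _) (norm_nonneg _)
    refine (norm_sum_le_of_le _ fun j _ => h1 l j).trans (le_of_eq ?_)
    simp
  refine (norm_sum_le_of_le _ fun l _ => h2 l).trans (le_of_eq ?_)
  simp
  ring

/-- The constant `1/(6n⁴)` in front of the cross term of the Lyapunov functional. -/
def crossConst (n : ℕ) : ℝ := 1 / (6 * (n : ℝ) ^ 4)

/-- The cross term of the Lyapunov functional. -/
def crossTerm {n N : ℕ} (k : Space n) (y : MultiIdx n N → ℂ) : ℝ :=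
  inner ℝ (y (zeroIdx n N)) (-Complex.I * momentum k y)

/-- The Lyapunov functional of the Fourier mode of frequency `k`. -/
def lyapunov {n N : ℕ} (k : Space n) (y : MultiIdx n N → ℂ) : ℝ :=
  weightSq y + crossConst n / (1 + ‖k‖ ^ 2) * crossTerm k y

/-- The derivative of the cross term along the flow. -/
def crossTermDeriv {n N : ℕ} (k : Space n) (y : MultiIdx n N → ℂ) : ℝ :=
  ‖momentum k y‖ ^ 2 - ‖k‖ ^ 2 * ‖y (zeroIdx n N)‖ ^ 2 -
    inner ℝ (y (zeroIdx n N)) (stress k y) +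
    inner ℝ (y (zeroIdx n N)) (Complex.I * momentum k y)

theorem abs_crossTerm_le {n N : ℕ} (k : Space n) (y : MultiIdx n N → ℂ) :
    |crossTerm k y| ≤ ‖y (zeroIdx n N)‖ * (n * ‖k‖ * Real.sqrt (fluctSq y)) := by
  refine (abs_real_inner_le_norm _ _).trans ?_
  rw [norm_mul, norm_neg, Complex.norm_I, one_mul]
  exact mul_le_mul_of_nonneg_left (norm_momentum_le k y) (norm_nonneg _)

/-- Since `|k| ≤ (1+|k|²)/2`, the factor `1/(1+|k|²)` makes the cross term bounded relative to the
energy at all frequencies, and `crossConst n * n ≤ 1` makes the ratio at most one half. -/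
theorem abs_lyapunov_sub_le {n N : ℕ} (hn : 0 < n) (k : Space n) (y : MultiIdx n N → ℂ) :
    |lyapunov k y - weightSq y| ≤ weightSq y / 2 := by
  have h1 := abs_crossTerm_le k y
  have hν : (1 : ℝ) ≤ n := Nat.one_le_cast.2 hn
  have hδ : crossConst n * n ≤ 1 := by
    rw [crossConst, div_mul_eq_mul_div, one_mul, div_le_one (by positivity)]
    have : (1 : ℝ) ≤ (n : ℝ) ^ 3 := one_le_pow₀ hν
    nlinarith
  have hδ0 : 0 ≤ crossConst n := by rw [crossConst]; positivity
  have ha := norm_nonneg (y (zeroIdx n N))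
  have hη := Real.sqrt_nonneg (fluctSq y)
  have hη2 := Real.sq_sqrt (fluctSq_nonneg y)
  have hk := norm_nonneg k
  rw [lyapunov, add_sub_cancel_left, abs_mul, abs_of_nonneg (by positivity), weightSq_eq, ← hη2]
  set a := ‖y (zeroIdx n N)‖
  set η := Real.sqrt (fluctSq y)
  rw [div_mul_eq_mul_div, div_le_iff₀ (by positivity)]
  calc crossConst n * |crossTerm k y| ≤ crossConst n * (a * (n * ‖k‖ * η)) :=
        mul_le_mul_of_nonneg_left h1 hδ0
    _ = (crossConst n * n) * (‖k‖ * (a * η)) := by ring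
    _ ≤ 1 * (‖k‖ * (a * η)) := mul_le_mul_of_nonneg_right hδ (by positivity)
    _ = ‖k‖ * (a * η) := one_mul _
    _ ≤ ((1 + ‖k‖ ^ 2) / 2) * (a ^ 2 + η ^ 2) := by
        refine mul_le_mul ?_ ?_ (by positivity) (by positivity)
        · nlinarith [sq_nonneg (‖k‖ - 1)]
        · nlinarith [sq_nonneg (a - η)]
    _ = (a ^ 2 + η ^ 2) / 2 * (1 + ‖k‖ ^ 2) := by ring

/-- The Lyapunov inequality, as an inequality between real numbers. -/
theorem lyapunov_real_inequality {ν κ a η Z W : ℝ} (hν : 1 ≤ ν) (ha : 0 ≤ a)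
    (hZ0 : 0 ≤ Z) (hZ : Z ≤ ν * κ * η) (hW : W ≤ 2 * ν ^ 2 * κ ^ 2 * η) :
    -2 * η ^ 2 * (1 + κ ^ 2) + 1 / (6 * ν ^ 4) * (Z ^ 2 - κ ^ 2 * a ^ 2 + a * W + a * Z) ≤
      -(1 / (6 * ν ^ 4) / 2 * κ ^ 2) * (a ^ 2 + η ^ 2) := by
  have h1 : Z ^ 2 ≤ (ν * κ * η) ^ 2 := pow_le_pow_left₀ hZ0 hZ 2
  -- Young's inequality: the two cross products each spend a quarter of the damping `κ²a²`, leaving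
  -- half of it.
  have h2 : a * W ≤ κ ^ 2 * a ^ 2 / 4 + 4 * ν ^ 4 * κ ^ 2 * η ^ 2 := by
    have := mul_le_mul_of_nonneg_left hW ha
    nlinarith [sq_nonneg (κ * a / 2 - 2 * ν ^ 2 * κ * η)]
  have h3 : a * Z ≤ κ ^ 2 * a ^ 2 / 4 + ν ^ 2 * η ^ 2 := by
    have := mul_le_mul_of_nonneg_left hZ ha
    nlinarith [sq_nonneg (κ * a / 2 - ν * η)]
  have hν2 : ν ^ 2 ≤ ν ^ 4 := pow_le_pow_right₀ hν (by norm_num)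
  have hν4 : 1 ≤ ν ^ 4 := one_le_pow₀ hν
  have hp : 0 < 6 * ν ^ 4 := by positivity
  have h4 : Z ^ 2 - κ ^ 2 * a ^ 2 + a * W + a * Z ≤
      -(κ ^ 2 * a ^ 2 / 2) + (5 * ν ^ 4 * κ ^ 2 * η ^ 2 + ν ^ 4 * η ^ 2) := by
    have h5 : ν ^ 2 * (κ ^ 2 * η ^ 2) ≤ ν ^ 4 * (κ ^ 2 * η ^ 2) :=
      mul_le_mul_of_nonneg_right hν2 (by positivity)
    have h6 : ν ^ 2 * η ^ 2 ≤ ν ^ 4 * η ^ 2 := mul_le_mul_of_nonneg_right hν2 (by positivity)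
    nlinarith
  have h7 : κ ^ 2 * η ^ 2 ≤ ν ^ 4 * (κ ^ 2 * η ^ 2) :=
    le_mul_of_one_le_left (by positivity) hν4
  -- The errors add up to at most `5ν⁴κ²η² + ν⁴η²`; the prefactor `1/(6ν⁴)` is small enough for the
  -- dissipation `2η²(1+κ²)` to absorb them and still leave `κ²η²/2`.
  have h8 : (6 * ν ^ 4) * (-2 * η ^ 2 * (1 + κ ^ 2)) +
      (Z ^ 2 - κ ^ 2 * a ^ 2 + a * W + a * Z) ≤ -(κ ^ 2 / 2) * (a ^ 2 + η ^ 2) := by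
    have : 0 ≤ ν ^ 4 * η ^ 2 := by positivity
    nlinarith
  have h9 := mul_le_mul_of_nonneg_left h8 (one_div_pos.2 hp).le
  calc _ = 1 / (6 * ν ^ 4) * ((6 * ν ^ 4) * (-2 * η ^ 2 * (1 + κ ^ 2)) +
      (Z ^ 2 - κ ^ 2 * a ^ 2 + a * W + a * Z)) := by field_simp
    _ ≤ _ := h9
    _ = _ := by ring

/-- The decay rate `(δ/3) |k|²/(1+|k|²)` of the Lyapunov functional. -/
def decayRate (n : ℕ) (κ : ℝ) : ℝ := crossConst n / 3 * (κ ^ 2 / (1 + κ ^ 2))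

theorem lyapunov_dissipation {n N : ℕ} (hn : 0 < n) (k : Space n) (y : MultiIdx n N → ℂ) :
    -2 * (∑ β, ((∑ i, β.1 i : ℕ) : ℝ) * (‖y β‖ ^ 2 / multiFactorial β.1)) +
      crossConst n / (1 + ‖k‖ ^ 2) * crossTermDeriv k y ≤ -decayRate n ‖k‖ * lyapunov k y := by
  have hν : (1 : ℝ) ≤ n := Nat.one_le_cast.2 hn
  have hδ0 : 0 ≤ crossConst n := by rw [crossConst]; positivity
  have hη2 := Real.sq_sqrt (fluctSq_nonneg y)
  have h1 := lyapunov_real_inequality hν (norm_nonneg (y (zeroIdx n N)))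
    (norm_nonneg _) (norm_momentum_le k y) (norm_stress_le k y)
  have h2 : crossTermDeriv k y ≤ ‖momentum k y‖ ^ 2 - ‖k‖ ^ 2 * ‖y (zeroIdx n N)‖ ^ 2 +
      ‖y (zeroIdx n N)‖ * ‖stress k y‖ + ‖y (zeroIdx n N)‖ * ‖momentum k y‖ := by
    have h3 := (abs_le.1 (abs_real_inner_le_norm (y (zeroIdx n N)) (stress k y))).1
    have h4 := real_inner_le_norm (y (zeroIdx n N)) (Complex.I * momentum k y)
    rw [norm_mul, Complex.norm_I, one_mul] at h4
    rw [crossTermDeriv]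
    linarith
  rw [hη2, ← weightSq_eq] at h1
  have h5 := (abs_le.1 (abs_lyapunov_sub_le hn k y)).2
  have hp : 0 < 1 + ‖k‖ ^ 2 := by positivity
  have h6 := fluctSq_le_dissipation y
  have h7 : -2 * fluctSq y + crossConst n / (1 + ‖k‖ ^ 2) * crossTermDeriv k y ≤
      -(crossConst n / 2 * (‖k‖ ^ 2 / (1 + ‖k‖ ^ 2))) * weightSq y := by
    have h8 := mul_le_mul_of_nonneg_left h2 hδ0
    rw [← crossConst] at h1
    have h9 : (-2 * fluctSq y * (1 + ‖k‖ ^ 2) + crossConst n * crossTermDeriv k y) /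
        (1 + ‖k‖ ^ 2) ≤ (-(crossConst n / 2 * ‖k‖ ^ 2) * weightSq y) / (1 + ‖k‖ ^ 2) :=
      div_le_div_of_nonneg_right (by linarith) hp.le
    calc _ = (-2 * fluctSq y * (1 + ‖k‖ ^ 2) + crossConst n * crossTermDeriv k y) /
        (1 + ‖k‖ ^ 2) := by field_simp
      _ ≤ _ := h9
      _ = _ := by ring
  have h10 : 0 ≤ decayRate n ‖k‖ := by rw [decayRate]; positivity
  -- The inequality in terms of the energy has rate `δ/2`, with `δ = crossConst n`; as the
  -- functional is at most `3/2` of the energy, the rate becomes `δ/3`.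
  have h11 : decayRate n ‖k‖ * lyapunov k y ≤ decayRate n ‖k‖ * (3 / 2 * weightSq y) :=
    mul_le_mul_of_nonneg_left (by linarith) h10
  have h12 : decayRate n ‖k‖ * (3 / 2 * weightSq y) =
      (crossConst n / 2 * (‖k‖ ^ 2 / (1 + ‖k‖ ^ 2))) * weightSq y := by
    rw [decayRate]; ring
  linarith

/-! ### Decay along the ODE of a single Fourier mode. -/

section Flow

variable {n N : ℕ} {k : Space n} {y : ℝ → MultiIdx n N → ℂ}

theorem hasDerivAt_weightSq
    (hy : ∀ t, HasDerivAt y (-(symbolMatrix n N k).mulVec (y t)) t) (t : ℝ) :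
    HasDerivAt (fun t => weightSq (y t))
      (-2 * (∑ β, ((∑ i, β.1 i : ℕ) : ℝ) * (‖y t β‖ ^ 2 / multiFactorial β.1))) t := by
  have h1 : ∀ β ∈ (Finset.univ : Finset (MultiIdx n N)),
      HasDerivAt (fun t => ‖y t β‖ ^ 2 / multiFactorial β.1)
        (2 * inner ℝ (y t β) (-(symbolMatrix n N k).mulVec (y t) β) / multiFactorial β.1) t := by
    intro β _
    exact ((hasDerivAt_pi.1 (hy t) β).norm_sq).div_const _
  refine (HasDerivAt.fun_sum h1).congr_deriv ?_
  rw [← sum_inner_symbolMatrix k (y t), Finset.mul_sum]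
  refine Finset.sum_congr rfl fun β _ => ?_
  rw [inner_neg_right]
  ring

theorem hasDerivAt_momentum (hN : 1 ≤ N)
    (hy : ∀ t, HasDerivAt y (-(symbolMatrix n N k).mulVec (y t)) t) (t : ℝ) :
    HasDerivAt (fun t => momentum k (y t))
      (-(Complex.I * ((‖k‖ ^ 2 : ℝ) * y t (zeroIdx n N) + stress k (y t)) +
        momentum k (y t))) t := by
  rw [← momentum_symbolMatrix hN]
  have h1 : ∀ α : Fin n → ℕ, HasDerivAt (fun t => extendZero (y t) α)
      (-extendZero ((symbolMatrix n N k).mulVec (y t)) α) t := by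
    intro α
    unfold extendZero
    split_ifs with h
    · exact hasDerivAt_pi.1 (hy t) _
    · simpa using hasDerivAt_const t (0 : ℂ)
  unfold momentum
  refine (HasDerivAt.fun_sum fun j _ => (h1 (Pi.single j 1)).const_mul (k j : ℂ)).congr_deriv ?_
  simp

theorem hasDerivAt_crossTerm (hN : 1 ≤ N)
    (hy : ∀ t, HasDerivAt y (-(symbolMatrix n N k).mulVec (y t)) t) (t : ℝ) :
    HasDerivAt (fun t => crossTerm k (y t)) (crossTermDeriv k (y t)) t := by
  have h0 : HasDerivAt (fun t => y t (zeroIdx n N)) (-Complex.I * momentum k (y t)) t := by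
    refine (hasDerivAt_pi.1 (hy t) (zeroIdx n N)).congr_deriv ?_
    rw [Pi.neg_apply, symbolMatrix_mulVec_zeroIdx, neg_mul]
  have h1 := (hasDerivAt_momentum hN hy t).const_mul (-Complex.I)
  refine (h0.inner ℝ h1).congr_deriv ?_
  rw [real_inner_self_eq_norm_sq, norm_mul, norm_neg, Complex.norm_I, one_mul, crossTermDeriv]
  have h2 : -Complex.I * -(Complex.I * ((‖k‖ ^ 2 : ℝ) * y t (zeroIdx n N) + stress k (y t)) +
      momentum k (y t)) = -((‖k‖ ^ 2 : ℝ) • y t (zeroIdx n N)) - stress k (y t) +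
      Complex.I * momentum k (y t) := by
    rw [Complex.real_smul]
    linear_combination ((‖k‖ ^ 2 : ℝ) * y t (zeroIdx n N) + stress k (y t)) * Complex.I_mul_I
  rw [h2, inner_add_right, inner_sub_right, inner_neg_right, real_inner_smul_right,
    real_inner_self_eq_norm_sq]
  ring

/-- Every Fourier mode decays at a rate which does not depend on `N`. -/
theorem weightSq_decay (hn : 0 < n) (hN : 1 ≤ N)
    (hy : ∀ t, HasDerivAt y (-(symbolMatrix n N k).mulVec (y t)) t) {t : ℝ} (ht : 0 ≤ t) :
    weightSq (y t) ≤ 3 * Real.exp (-decayRate n ‖k‖ * t) * weightSq (y 0) := by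
  set ρ := decayRate n ‖k‖
  have h1 : ∀ t, HasDerivAt (fun t => lyapunov k (y t) * Real.exp (ρ * t))
      ((-2 * (∑ β, ((∑ i, β.1 i : ℕ) : ℝ) * (‖y t β‖ ^ 2 / multiFactorial β.1)) +
        crossConst n / (1 + ‖k‖ ^ 2) * crossTermDeriv k (y t)) * Real.exp (ρ * t) +
        lyapunov k (y t) * (Real.exp (ρ * t) * (ρ * 1))) t := fun t =>
    ((hasDerivAt_weightSq hy t).add ((hasDerivAt_crossTerm hN hy t).const_mul _)).mul
      (((hasDerivAt_id t).const_mul ρ).exp)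
  have h2 : Antitone fun t => lyapunov k (y t) * Real.exp (ρ * t) := by
    refine antitone_of_deriv_nonpos (fun t => (h1 t).differentiableAt) fun t => ?_
    rw [(h1 t).deriv]
    have h3 := lyapunov_dissipation hn k (y t)
    have h4 := mul_le_mul_of_nonneg_right h3 (Real.exp_pos (ρ * t)).le
    linarith
  have h3 := h2 ht
  simp only [mul_zero, Real.exp_zero, mul_one] at h3
  -- The functional lies between `1/2` and `3/2` of the energy; the quotient is the factor 3 in the
  -- bound.
  have h4 := (abs_le.1 (abs_lyapunov_sub_le hn k (y t))).1
  have h5 := (abs_le.1 (abs_lyapunov_sub_le hn k (y 0))).2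
  have h6 : lyapunov k (y t) ≤ Real.exp (-ρ * t) * lyapunov k (y 0) := by
    have := mul_le_mul_of_nonneg_left h3 (Real.exp_pos (-ρ * t)).le
    rwa [mul_left_comm, ← Real.exp_add, show -ρ * t + ρ * t = 0 by ring, Real.exp_zero,
      mul_one] at this
  have h7 : Real.exp (-ρ * t) * lyapunov k (y 0) ≤
      Real.exp (-ρ * t) * (3 / 2 * weightSq (y 0)) :=
    mul_le_mul_of_nonneg_left (by linarith) (Real.exp_pos _).le
  linarith

end Flow

/-! ### The Fourier transform on `L¹ ∩ L²` -/

section Fourier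

variable {n : ℕ}

open scoped SchwartzMap

/-- The `L²` transform agrees with that of tempered distributions, which is defined by this duality.
-/
theorem integral_lpFourier_mul (f : Lp ℂ 2 (volume : Measure (Space n))) (g : 𝓢(Space n, ℂ)) :
    ∫ x, (𝓕 f : Lp ℂ 2 (volume : Measure (Space n))) x * g x = ∫ x, f x * (𝓕 g) x := by
  have h := congrArg (fun T => T g) (Lp.fourier_toTemperedDistribution_eq f)
  simp only [TemperedDistribution.fourier_apply, Lp.toTemperedDistribution_apply,
    smul_eq_mul] at h
  simp only [mul_comm _ (g _), mul_comm _ ((𝓕 g) _)]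
  exact h.symm

theorem integral_lpFourierInv_mul (f : Lp ℂ 2 (volume : Measure (Space n)))
    (g : 𝓢(Space n, ℂ)) :
    ∫ x, (𝓕⁻ f : Lp ℂ 2 (volume : Measure (Space n))) x * g x = ∫ x, f x * (𝓕⁻ g) x := by
  have h := congrArg (fun T => T g) (Lp.fourierInv_toTemperedDistribution_eq f)
  simp only [TemperedDistribution.fourierInv_apply, Lp.toTemperedDistribution_apply,
    smul_eq_mul] at h
  simp only [mul_comm _ (g _), mul_comm _ ((𝓕⁻ g) _)]
  exact h.symm

theorem integral_fourier_mul_eq {f g : Space n → ℂ} (hf : Integrable f) (hg : Integrable g) :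
    ∫ x, 𝓕 f x * g x = ∫ x, f x * 𝓕 g x := by
  simpa using! VectorFourier.integral_fourierIntegral_smul_eq_flip (L := innerₗ (Space n))
    Real.continuous_fourierChar continuous_inner hf hg

theorem integral_fourierInv_mul_eq {f g : Space n → ℂ} (hf : Integrable f) (hg : Integrable g) :
    ∫ x, 𝓕⁻ f x * g x = ∫ x, f x * 𝓕⁻ g x := by
  have h1 : ∀ x, 𝓕⁻ g x = 𝓕 (fun y => g (-y)) x := fun x => by
    rw [Real.fourierInv_eq_fourier_comp_neg]
  simp only [h1]
  rw [← integral_fourier_mul_eq hf hg.comp_neg,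
    ← integral_neg_eq_self (fun x => 𝓕 f x * g (-x))]
  simp only [neg_neg, Real.fourierInv_eq_fourier_neg]

theorem continuous_fourier {E : Type*} [NormedAddCommGroup E] [NormedSpace ℂ E]
    {f : Space n → E} (hf : Integrable f) : Continuous (𝓕 f) :=
  VectorFourier.fourierIntegral_continuous Real.continuous_fourierChar
    (by exact continuous_inner) hf

theorem continuous_fourierInv {f : Space n → ℂ} (hf : Integrable f) : Continuous (𝓕⁻ f) := by
  have h1 : 𝓕⁻ f = fun x => 𝓕 f (-x) := funext fun x => Real.fourierInv_eq_fourier_neg f x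
  rw [h1]
  exact (continuous_fourier hf).comp continuous_neg

theorem locallyIntegrable_lp (f : Lp ℂ 2 (volume : Measure (Space n))) :
    LocallyIntegrable f volume :=
  (Lp.memLp f).locallyIntegrable (by norm_num)

/-- Two locally integrable functions with the same integrals against complex test functions
agree almost everywhere. -/
theorem ae_eq_of_integral_mul_eq {f g : Space n → ℂ} (hf : LocallyIntegrable f)
    (hg : LocallyIntegrable g)
    (h : ∀ φ : Space n → ℂ, ContDiff ℝ ∞ φ → HasCompactSupport φ →
      ∫ x, f x * φ x = ∫ x, g x * φ x) : f =ᵐ[volume] g := by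
  refine ae_eq_of_integral_contDiff_smul_eq hf hg fun φ hφ hc => ?_
  have h1 := h (fun x => (φ x : ℂ)) (Complex.ofRealCLM.contDiff.comp hφ)
    (hc.comp_left (g := Complex.ofReal) Complex.ofReal_zero)
  simpa only [Complex.real_smul, mul_comm] using h1

/-- The `L²` transform and the integral transform satisfy the same multiplication formula against
test functions. -/
theorem lpFourier_ae_eq {f : Lp ℂ 2 (volume : Measure (Space n))}
    (hf : Integrable f) : (𝓕 f : Lp ℂ 2 (volume : Measure (Space n))) =ᵐ[volume]
      𝓕 (f : Space n → ℂ) := by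
  refine ae_eq_of_integral_mul_eq (locallyIntegrable_lp _)
    (continuous_fourier hf).locallyIntegrable fun φ hφ hc => ?_
  have h1 := integral_lpFourier_mul f (hc.toSchwartzMap hφ)
  have h2 := integral_fourier_mul_eq hf (hc.toSchwartzMap hφ).integrable
  rw [SchwartzMap.fourier_coe, ← h2] at h1
  exact h1

theorem lpFourierInv_ae_eq {f : Lp ℂ 2 (volume : Measure (Space n))}
    (hf : Integrable f) : (𝓕⁻ f : Lp ℂ 2 (volume : Measure (Space n))) =ᵐ[volume]
      𝓕⁻ (f : Space n → ℂ) := by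
  refine ae_eq_of_integral_mul_eq (locallyIntegrable_lp _)
    (continuous_fourierInv hf).locallyIntegrable fun φ hφ hc => ?_
  have h1 := integral_lpFourierInv_mul f (hc.toSchwartzMap hφ)
  have h2 := integral_fourierInv_mul_eq hf (hc.toSchwartzMap hφ).integrable
  rw [SchwartzMap.fourierInv_coe, ← h2] at h1
  exact h1

/-- A square integrable function with integrable Fourier transform is given by the inversion
formula. -/
theorem ae_eq_fourierInv {f : Lp ℂ 2 (volume : Measure (Space n))}
    (hf : Integrable (𝓕 f : Lp ℂ 2 (volume : Measure (Space n)))) :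
    f =ᵐ[volume] 𝓕⁻ ((𝓕 f : Lp ℂ 2 (volume : Measure (Space n))) : Space n → ℂ) := by
  have h := lpFourierInv_ae_eq hf
  rwa [FourierTransform.fourierInv_fourier_eq] at h

/-- The moments commute with the Fourier transform in `x`. -/
theorem fourier_moment {F : Space n → L2w n} (hF : Integrable F) (α : Fin n → ℕ) (ξ : Space n) :
    𝓕 (fun x => moment α (F x)) ξ = moment α (𝓕 F ξ) := by
  have h1 : ∀ f : L2w n, moment α f = innerSL ℂ (hermiteLp α) f := fun f => by
    rw [innerSL_apply_apply, inner_hermiteLp]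
  simp only [h1]
  rw [Real.fourier_eq, Real.fourier_eq, ← ContinuousLinearMap.integral_comp_comm]
  · refine integral_congr_ae (ae_of_all _ fun x => ?_)
    simp only [Circle.smul_def, map_smul]
  · exact (Real.fourierIntegral_convergent_iff ξ).2 hF

theorem integrable_moment {F : Space n → L2w n} (hF : Integrable F) (α : Fin n → ℕ) :
    Integrable fun x => moment α (F x) := by
  have h1 : ∀ f : L2w n, moment α f = innerSL ℂ (hermiteLp α) f := fun f => by
    rw [innerSL_apply_apply, inner_hermiteLp]
  simp only [h1]
  exact (innerSL ℂ (hermiteLp α)).integrable_comp hF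

end Fourier

/-! ### Extension of the weak formulation to Schwartz functions -/

section Weak

variable {n : ℕ}

open scoped SchwartzMap

theorem integrable_lp_mul (f : Lp ℂ 2 (volume : Measure (Space n))) {φ : Space n → ℂ}
    (hφ : MemLp φ 2) : Integrable fun x => f x * φ x :=
  (Lp.memLp f).integrable_mul hφ

theorem norm_integral_lp_mul_le (f : Lp ℂ 2 (volume : Measure (Space n))) {φ : Space n → ℂ}
    (hφ : MemLp φ 2) : ‖∫ x, f x * φ x‖ ≤ ‖f‖ * (eLpNorm φ 2 volume).toReal := by
  have hs : MemLp (fun x => starRingEnd ℂ (φ x)) 2 volume := hφ.star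
  have h1 : ∫ x, f x * φ x = inner ℂ (hs.toLp _) f := by
    rw [L2.inner_def]
    refine integral_congr_ae ?_
    filter_upwards [hs.coeFn_toLp] with x hx
    rw [hx]
    simp
  have h2 : ‖hs.toLp _‖ = (eLpNorm φ 2 volume).toReal := by
    rw [Lp.norm_toLp]
    congr 1
    exact eLpNorm_congr_norm_ae (ae_of_all _ fun x => by simp)
  rw [h1, mul_comm, ← h2]
  exact norm_inner_le_norm _ _

theorem norm_integral_lp_mul_sub_le (f : Lp ℂ 2 (volume : Measure (Space n)))
    {φ φ' : Space n → ℂ} (hφ : MemLp φ 2) (hφ' : MemLp φ' 2) {g : Space n → ℝ} (hg : MemLp g 2)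
    {c : ℝ} (h : ∀ x, ‖φ' x - φ x‖ ≤ c * g x) :
    ‖(∫ x, f x * φ' x) - ∫ x, f x * φ x‖ ≤ ‖f‖ * (|c| * (eLpNorm g 2 volume).toReal) := by
  rw [← integral_sub (integrable_lp_mul f hφ') (integrable_lp_mul f hφ)]
  simp only [← mul_sub]
  refine (norm_integral_lp_mul_le f (hφ'.sub hφ)).trans
    (mul_le_mul_of_nonneg_left ?_ (norm_nonneg _))
  have h1 : eLpNorm (φ' - φ) 2 volume ≤ eLpNorm (c • g) 2 volume :=
    eLpNorm_mono_real h
  rw [eLpNorm_const_smul] at h1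
  refine (ENNReal.toReal_mono (ENNReal.mul_ne_top enorm_ne_top hg.eLpNorm_ne_top) h1).trans ?_
  rw [ENNReal.toReal_mul]
  simp

/-- A smooth cutoff function which is `1` on the unit ball. -/
def cutoffBump (n : ℕ) : ContDiffBump (0 : Space n) := ⟨1, 2, one_pos, one_lt_two⟩

/-- The cutoff function at scale `k + 1`. -/
def cutoff (n k : ℕ) (x : Space n) : ℝ := cutoffBump n (((k : ℝ) + 1)⁻¹ • x)

theorem contDiff_cutoff (n k : ℕ) : ContDiff ℝ ∞ (cutoff n k) :=
  (cutoffBump n).contDiff.comp (contDiff_const_smul _)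

theorem hasCompactSupport_cutoff (n k : ℕ) : HasCompactSupport (cutoff n k) :=
  (cutoffBump n).hasCompactSupport.comp_smul (by positivity)

/-- The difference vanishes for `‖x‖ ≤ k+1` and is at most 1 beyond, where `‖x‖/(k+1) ≥ 1`. A factor
`‖x‖`, absorbed by Schwartz decay, is exchanged for a rate in `k`. -/
theorem abs_cutoff_sub_one_le (n k : ℕ) (x : Space n) :
    |cutoff n k x - 1| ≤ ((k : ℝ) + 1)⁻¹ * ‖x‖ := by
  have hk : (0 : ℝ) < (k : ℝ) + 1 := by positivity
  rw [cutoff]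
  by_cases hx : ‖((k : ℝ) + 1)⁻¹ • x‖ ≤ 1
  · rw [(cutoffBump n).one_of_mem_closedBall (by simpa [cutoffBump] using hx)]
    simpa using (by positivity : (0 : ℝ) ≤ ((k : ℝ) + 1)⁻¹ * ‖x‖)
  · have h1 : ((k : ℝ) + 1)⁻¹ * ‖x‖ = ‖((k : ℝ) + 1)⁻¹ • x‖ := by
      rw [norm_smul, Real.norm_of_nonneg (by positivity)]
    have h2 := (cutoffBump n).nonneg (x := ((k : ℝ) + 1)⁻¹ • x)
    have h3 := (cutoffBump n).le_one (x := ((k : ℝ) + 1)⁻¹ • x)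
    rw [h1, abs_le]
    constructor <;> linarith

theorem exists_norm_fderiv_cutoff_le (n : ℕ) :
    ∃ D : ℝ, 0 ≤ D ∧ ∀ k x, ‖fderiv ℝ (cutoff n k) x‖ ≤ ((k : ℝ) + 1)⁻¹ * D := by
  have h1 : Continuous (fderiv ℝ (cutoffBump n)) :=
    ((cutoffBump n).contDiff (n := 1)).continuous_fderiv one_ne_zero
  obtain ⟨D, hD⟩ := h1.bounded_above_of_compact_support
    ((cutoffBump n).hasCompactSupport.fderiv ℝ)
  refine ⟨D, (norm_nonneg _).trans (hD 0), fun k x => ?_⟩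
  have hk : (0 : ℝ) < (k : ℝ) + 1 := by positivity
  have h2 : fderiv ℝ (cutoff n k) x =
      ((k : ℝ) + 1)⁻¹ • fderiv ℝ (cutoffBump n) (((k : ℝ) + 1)⁻¹ • x) :=
    fderiv_comp_smul _
  rw [h2, norm_smul, Real.norm_of_nonneg (by positivity)]
  exact mul_le_mul_of_nonneg_left (hD _) (by positivity)

/-- Truncation of a Schwartz function. -/
def truncate (k : ℕ) (φ : 𝓢(Space n, ℂ)) (x : Space n) : ℂ := cutoff n k x • φ x

theorem contDiff_truncate (k : ℕ) (φ : 𝓢(Space n, ℂ)) : ContDiff ℝ ∞ (truncate k φ) :=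
  (contDiff_cutoff n k).smul (φ.smooth ⊤)

theorem hasCompactSupport_truncate (k : ℕ) (φ : 𝓢(Space n, ℂ)) :
    HasCompactSupport (truncate k φ) := (hasCompactSupport_cutoff n k).smul_right

theorem memLp_norm_mul_norm {E : Type*} [NormedAddCommGroup E] [NormedSpace ℝ E]
    (φ : 𝓢(Space n, E)) : MemLp (fun x => ‖x‖ * ‖φ x‖) 2 volume := by
  have hq : Function.HasTemperateGrowth fun x : Space n => 1 + ‖x‖ ^ 2 := by fun_prop
  have h1 := (SchwartzMap.smulLeftCLM E (fun x : Space n => 1 + ‖x‖ ^ 2) φ).memLp 2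
    (volume : Measure (Space n))
  refine h1.mono (continuous_norm.mul φ.continuous.norm).aestronglyMeasurable
    (ae_of_all _ fun x => ?_)
  rw [SchwartzMap.smulLeftCLM_apply_apply hq, norm_smul, norm_mul, norm_norm, norm_norm]
  refine mul_le_mul_of_nonneg_right ?_ (norm_nonneg _)
  rw [Real.norm_of_nonneg (by positivity)]
  nlinarith [sq_nonneg (‖x‖ - 1)]

/-- One square integrable majorant serves the function and its first derivatives, so the truncation
error is `O(1/k)` in `L²`. -/
theorem exists_norm_truncate_sub_le (φ : 𝓢(Space n, ℂ)) :
    ∃ g : Space n → ℝ, MemLp g 2 volume ∧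
      (∀ k x, ‖truncate k φ x - φ x‖ ≤ ((k : ℝ) + 1)⁻¹ * g x) ∧
      ∀ j k x, ‖fderiv ℝ (truncate k φ) x (EuclideanSpace.single j 1) -
        fderiv ℝ φ x (EuclideanSpace.single j 1)‖ ≤ ((k : ℝ) + 1)⁻¹ * g x := by
  obtain ⟨D, hD0, hD⟩ := exists_norm_fderiv_cutoff_le n
  refine ⟨fun x => ‖x‖ * ‖φ x‖ + (‖x‖ * ‖SchwartzMap.fderivCLM ℝ (Space n) ℂ φ x‖ + D * ‖φ x‖),
    (memLp_norm_mul_norm φ).add ((memLp_norm_mul_norm _).add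
      ((φ.memLp 2 volume).norm.const_mul D)), fun k x => ?_, fun j k x => ?_⟩
  · have h1 : truncate k φ x - φ x = (cutoff n k x - 1) • φ x := by
      rw [truncate, sub_smul, one_smul]
    rw [h1, norm_smul]
    calc ‖cutoff n k x - 1‖ * ‖φ x‖ ≤ (((k : ℝ) + 1)⁻¹ * ‖x‖) * ‖φ x‖ :=
          mul_le_mul_of_nonneg_right (abs_cutoff_sub_one_le n k x) (norm_nonneg _)
      _ = ((k : ℝ) + 1)⁻¹ * (‖x‖ * ‖φ x‖) := by ring
      _ ≤ _ := by
        refine mul_le_mul_of_nonneg_left (le_add_of_nonneg_right ?_) (by positivity)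
        positivity
  · have h1 : HasFDerivAt (truncate k φ) (cutoff n k x • fderiv ℝ φ x +
        (fderiv ℝ (cutoff n k) x).smulRight (φ x)) x :=
      (((contDiff_cutoff n k).differentiable (by simp)) x).hasFDerivAt.smul (φ.hasFDerivAt x)
    have h2 : fderiv ℝ (truncate k φ) x (EuclideanSpace.single j 1) -
        fderiv ℝ φ x (EuclideanSpace.single j 1) =
        (cutoff n k x - 1) • fderiv ℝ φ x (EuclideanSpace.single j 1) +
        (fderiv ℝ (cutoff n k) x (EuclideanSpace.single j 1)) • φ x := by
      rw [h1.fderiv]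
      simp only [add_apply, smul_apply, ContinuousLinearMap.smulRight_apply]
      rw [sub_smul, one_smul]
      abel
    have he : ‖(EuclideanSpace.single j 1 : Space n)‖ = 1 := by simp
    have h3 : ‖fderiv ℝ φ x (EuclideanSpace.single j 1)‖ ≤
        ‖SchwartzMap.fderivCLM ℝ (Space n) ℂ φ x‖ := by
      rw [SchwartzMap.fderivCLM_apply]
      simpa [he] using (fderiv ℝ φ x).le_opNorm (EuclideanSpace.single j 1)
    have h4 : ‖fderiv ℝ (cutoff n k) x (EuclideanSpace.single j 1)‖ ≤ ((k : ℝ) + 1)⁻¹ * D := by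
      refine le_trans ?_ (hD k x)
      simpa [he] using (fderiv ℝ (cutoff n k) x).le_opNorm (EuclideanSpace.single j 1)
    rw [h2]
    refine (norm_add_le _ _).trans ?_
    rw [norm_smul, norm_smul]
    calc _ ≤ (((k : ℝ) + 1)⁻¹ * ‖x‖) * ‖SchwartzMap.fderivCLM ℝ (Space n) ℂ φ x‖ +
          (((k : ℝ) + 1)⁻¹ * D) * ‖φ x‖ :=
          add_le_add (mul_le_mul (abs_cutoff_sub_one_le n k x) h3 (norm_nonneg _) (by positivity))
            (mul_le_mul_of_nonneg_right h4 (norm_nonneg _))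
      _ = ((k : ℝ) + 1)⁻¹ *
          (‖x‖ * ‖SchwartzMap.fderivCLM ℝ (Space n) ℂ φ x‖ + D * ‖φ x‖) := by ring
      _ ≤ _ := by
        refine mul_le_mul_of_nonneg_left (le_add_of_nonneg_left ?_) (by positivity)
        positivity

variable {N : ℕ} {F : Space n → L2w n}
  {m : ℝ → MultiIdx n N → Lp ℂ 2 (volume : Measure (Space n))}

/-- The right-hand side of the weak formulation. -/
def weakRhs (v : MultiIdx n N → Lp ℂ 2 (volume : Measure (Space n))) (φ : Space n → ℂ)
    (β : MultiIdx n N) : ℂ :=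
  (∑ j, ∑ α, transportMatrix n N j β α *
      (∫ x, v α x * fderiv ℝ φ x (EuclideanSpace.single j 1)))
    - (∑ α, collisionMatrix n N β α * (∫ x, v α x * φ x))

/-- On a bounded time interval the `L²` norms of the moments are bounded, so the time derivatives of
the truncated pairings converge uniformly, and the limit may be differentiated. -/
theorem weak_schwartz (hm : IsGalerkinSolution N F m) (φ : 𝓢(Space n, ℂ)) (β : MultiIdx n N)
    {t : ℝ} (ht : 0 < t) :
    HasDerivAt (fun r => ∫ x, m r β x * φ x) (weakRhs (m t) φ β) t := by
  obtain ⟨g, hg, hg1, hg2⟩ := exists_norm_truncate_sub_le φ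
  set D := (eLpNorm g 2 volume).toReal
  obtain ⟨K, hK⟩ := (isCompact_Icc (a := (0 : ℝ)) (b := t + 1)).exists_bound_of_continuousOn
    (hm.continuousOn.mono Icc_subset_Ici_self)
  have hmem : ∀ k, MemLp (truncate k φ) 2 volume := fun k =>
    (contDiff_truncate k φ).continuous.memLp_of_hasCompactSupport (hasCompactSupport_truncate k φ)
  have hmem' : ∀ k (j : Fin n), MemLp (fun x => fderiv ℝ (truncate k φ) x
      (EuclideanSpace.single j 1)) 2 volume := fun k j => by
    refine Continuous.memLp_of_hasCompactSupport ?_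
      ((hasCompactSupport_truncate k φ).fderiv_apply ℝ _)
    exact ((contDiff_truncate k φ).continuous_fderiv (by simp)).clm_apply continuous_const
  have hφ' : ∀ j : Fin n, MemLp (fun x => fderiv ℝ φ x (EuclideanSpace.single j 1)) 2 volume :=
    fun j => (SchwartzMap.evalCLM ℝ (Space n) ℂ (EuclideanSpace.single j 1)
      (SchwartzMap.fderivCLM ℝ (Space n) ℂ φ)).memLp 2 volume
  have hb : ∀ k : ℕ, (0 : ℝ) ≤ ((k : ℝ) + 1)⁻¹ := fun k => by positivity
  have b1 : ∀ r ∈ Ioo 0 (t + 1), ∀ k α,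
      ‖(∫ x, m r α x * truncate k φ x) - ∫ x, m r α x * φ x‖ ≤ ((k : ℝ) + 1)⁻¹ * (K * D) := by
    intro r hr k α
    refine (norm_integral_lp_mul_sub_le (m r α) (φ.memLp 2 volume) (hmem k) hg (hg1 k)).trans ?_
    rw [abs_of_nonneg (hb k), mul_left_comm]
    exact mul_le_mul_of_nonneg_left (mul_le_mul_of_nonneg_right
      ((norm_le_pi_norm (m r) α).trans (hK r (Ioo_subset_Icc_self hr))) ENNReal.toReal_nonneg)
      (hb k)
  have b2 : ∀ r ∈ Ioo 0 (t + 1), ∀ k α (j : Fin n),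
      ‖(∫ x, m r α x * fderiv ℝ (truncate k φ) x (EuclideanSpace.single j 1)) -
        ∫ x, m r α x * fderiv ℝ φ x (EuclideanSpace.single j 1)‖ ≤
        ((k : ℝ) + 1)⁻¹ * (K * D) := by
    intro r hr k α j
    refine (norm_integral_lp_mul_sub_le (m r α) (hφ' j) (hmem' k j) hg (hg2 j k)).trans ?_
    rw [abs_of_nonneg (hb k), mul_left_comm]
    exact mul_le_mul_of_nonneg_left (mul_le_mul_of_nonneg_right
      ((norm_le_pi_norm (m r) α).trans (hK r (Ioo_subset_Icc_self hr))) ENNReal.toReal_nonneg)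
      (hb k)
  set S := (∑ j, ∑ α, ‖transportMatrix n N j β α‖ * (K * D)) +
    ∑ α, ‖collisionMatrix n N β α‖ * (K * D)
  have b3 : ∀ r ∈ Ioo 0 (t + 1), ∀ k : ℕ,
      ‖weakRhs (m r) (truncate k φ) β - weakRhs (m r) φ β‖ ≤ ((k : ℝ) + 1)⁻¹ * S := by
    intro r hr k
    rw [weakRhs, weakRhs, sub_sub_sub_comm, ← Finset.sum_sub_distrib, ← Finset.sum_sub_distrib]
    simp only [← Finset.sum_sub_distrib, ← mul_sub]
    refine (norm_sub_le _ _).trans ?_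
    rw [mul_add, Finset.mul_sum, Finset.mul_sum]
    simp only [Finset.mul_sum]
    refine add_le_add (norm_sum_le_of_le _ fun j _ => norm_sum_le_of_le _ fun α _ => ?_)
      (norm_sum_le_of_le _ fun α _ => ?_)
    · rw [norm_mul, mul_left_comm]
      exact mul_le_mul_of_nonneg_left (b2 r hr k α j) (norm_nonneg _)
    · rw [norm_mul, mul_left_comm]
      exact mul_le_mul_of_nonneg_left (b1 r hr k α) (norm_nonneg _)
  have hlim : ∀ c : ℝ, Tendsto (fun k : ℕ => ((k : ℝ) + 1)⁻¹ * c) atTop (𝓝 0) := fun c => by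
    simpa [one_div] using (tendsto_one_div_add_atTop_nhds_zero_nat (𝕜 := ℝ)).mul_const c
  -- The open interval excludes the time `0`, where the weak formulation gives only a one-sided
  -- derivative.
  refine hasDerivAt_of_tendstoUniformlyOn (l := atTop) (s := Ioo 0 (t + 1))
    (f := fun k r => ∫ x, m r β x * truncate k φ x)
    (f' := fun k r => weakRhs (m r) (truncate k φ) β) (g' := fun r => weakRhs (m r) φ β) isOpen_Ioo ?_ ?_ ?_ ⟨ht, by linarith⟩
  · rw [Metric.tendstoUniformlyOn_iff]
    intro ε hε
    filter_upwards [(hlim S).eventually (gt_mem_nhds hε)] with k hk r hr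
    rw [dist_comm, dist_eq_norm]
    exact (b3 r hr k).trans_lt hk
  · refine Eventually.of_forall fun k r hr => ?_
    exact (hm.weak _ (contDiff_truncate k φ) (hasCompactSupport_truncate k φ) β r
      (le_of_lt hr.1)).hasDerivAt (Ici_mem_nhds hr.1)
  · intro r hr
    rw [tendsto_iff_norm_sub_tendsto_zero]
    exact squeeze_zero (fun k => norm_nonneg _) (fun k => b1 r hr k β) (hlim _)

end Weak

/-! ### The Galerkin system on the Fourier side -/

section FourierSide

variable {n N : ℕ} {F : Space n → L2w n}
  {m : ℝ → MultiIdx n N → Lp ℂ 2 (volume : Measure (Space n))}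

open scoped SchwartzMap

/-- The Fourier transform on `L²(ℝⁿ)`. -/
abbrev lpHat (f : Lp ℂ 2 (volume : Measure (Space n))) : Lp ℂ 2 (volume : Measure (Space n)) :=
  𝓕 f

theorem symbolMatrix_apply (k : Space n) (β α : MultiIdx n N) :
    symbolMatrix n N k β α =
      (∑ j, (Complex.I * (k j : ℂ)) * transportMatrix n N j β α) + collisionMatrix n N β α := by
  rw [symbolMatrix, Matrix.add_apply, Matrix.sum_apply]
  simp only [Matrix.smul_apply, smul_eq_mul]

/-- A derivative of `𝓕 ψ` is the transform of `-2πi ξ_j ψ`; duality then moves the transform onto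
`f`. -/
theorem integral_mul_fderiv_fourier (f : Lp ℂ 2 (volume : Measure (Space n)))
    (ψ : 𝓢(Space n, ℂ)) (j : Fin n) :
    ∫ x, f x * fderiv ℝ (𝓕 ψ : 𝓢(Space n, ℂ)) x (EuclideanSpace.single j 1) =
      -∫ ξ, lpHat f ξ * ((Complex.I * (((2 * Real.pi) • ξ) j : ℝ)) * ψ ξ) := by
  have hq : Function.HasTemperateGrowth fun x : Space n =>
      (inner ℝ x (EuclideanSpace.single j 1) : ℝ) := by fun_prop
  have h1 := SchwartzMap.lineDerivOp_fourier_eq ψ (EuclideanSpace.single j 1)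
  have h2 := integral_lpFourier_mul f (-(2 * Real.pi * Complex.I) •
    SchwartzMap.smulLeftCLM ℂ (fun x : Space n => (inner ℝ x (EuclideanSpace.single j 1) : ℝ)) ψ)
  rw [← h1] at h2
  simp only [SchwartzMap.lineDerivOp_apply_eq_fderiv] at h2
  rw [← h2, ← integral_neg]
  refine integral_congr_ae (ae_of_all _ fun ξ => ?_)
  have h3 : (inner ℝ ξ (EuclideanSpace.single j 1) : ℝ) = ξ j := by
    rw [EuclideanSpace.inner_single_right]
    simp
  simp only [smul_apply, SchwartzMap.smulLeftCLM_apply_apply hq, h3]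
  simp only [smul_eq_mul, Complex.real_smul, PiLp.smul_apply]
  push_cast
  ring

theorem memLp_mul_schwartz {q : Space n → ℂ} (hq : q.HasTemperateGrowth) (ψ : 𝓢(Space n, ℂ)) :
    MemLp (fun ξ => q ξ * ψ ξ) 2 volume := by
  have h := (SchwartzMap.smulLeftCLM ℂ q ψ).memLp 2 (volume : Measure (Space n))
  exact h.ae_eq (ae_of_all _ fun x => by simp [SchwartzMap.smulLeftCLM_apply_apply hq])

/-- The weak formulation is tested against `𝓕 ψ`, which is Schwartz but in general not compactly
supported. The frequency `2πξ` comes from the normalisation of the transform. -/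
theorem weak_fourier (hm : IsGalerkinSolution N F m) (ψ : 𝓢(Space n, ℂ)) (β : MultiIdx n N)
    {t : ℝ} (ht : 0 < t) :
    HasDerivAt (fun r => ∫ ξ, lpHat (m r β) ξ * ψ ξ)
      (-∑ α, ∫ ξ, lpHat (m t α) ξ *
        (symbolMatrix n N ((2 * Real.pi) • ξ) β α * ψ ξ)) t := by
  have h1 := weak_schwartz hm (𝓕 ψ : 𝓢(Space n, ℂ)) β ht
  simp only [← integral_lpFourier_mul] at h1
  refine h1.congr_deriv ?_
  rw [weakRhs]
  simp only [integral_mul_fderiv_fourier, ← integral_lpFourier_mul]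
  rw [Finset.sum_comm, ← Finset.sum_sub_distrib, ← Finset.sum_neg_distrib]
  refine Finset.sum_congr rfl fun α _ => ?_
  have hint : ∀ j : Fin n, Integrable fun ξ => transportMatrix n N j β α *
      (lpHat (m t α) ξ * ((Complex.I * (((2 * Real.pi) • ξ) j : ℝ)) * ψ ξ)) := fun j => by
    refine (integrable_lp_mul _ (memLp_mul_schwartz ?_ ψ)).const_mul _
    have h : (fun ξ : Space n => Complex.I * ((((2 * Real.pi) • ξ) j : ℝ) : ℂ)) =
        ((Complex.I • Complex.ofRealCLM).comp
          ((2 * Real.pi) • (EuclideanSpace.proj j : Space n →L[ℝ] ℝ))) := by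
      ext ξ
      simp [mul_left_comm]
    rw [h]
    exact ContinuousLinearMap.hasTemperateGrowth _
  have h2 : ∀ ξ, lpHat (m t α) ξ * (symbolMatrix n N ((2 * Real.pi) • ξ) β α * ψ ξ) =
      (∑ j, transportMatrix n N j β α *
        (lpHat (m t α) ξ * ((Complex.I * (((2 * Real.pi) • ξ) j : ℝ)) * ψ ξ))) +
      collisionMatrix n N β α * (lpHat (m t α) ξ * ψ ξ) := by
    intro ξ
    rw [symbolMatrix_apply, add_mul, mul_add, Finset.sum_mul, Finset.mul_sum]
    congr 1
    · exact Finset.sum_congr rfl fun j _ => by ring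
    · ring
  simp only [h2]
  rw [integral_add (integrable_finsetSum _ fun j _ => hint j)
    ((integrable_lp_mul _ (ψ.memLp 2 volume)).const_mul _), integral_finsetSum _ fun j _ => hint j]
  simp only [integral_const_mul]
  simp only [mul_neg, Finset.sum_neg_distrib]
  rw [neg_add, sub_eq_add_neg]

end FourierSide

/-! ### Identification of the solution on the Fourier side -/

/-- A product rule in which one factor is only known to be differentiable weakly. -/
theorem hasDerivAt_bilinear_of_weak {H Y : Type*} [NormedAddCommGroup H] [NormedSpace ℂ H]
    [NormedAddCommGroup Y] [NormedSpace ℂ Y] (B : H →L[ℂ] Y →L[ℂ] ℂ) {f : ℝ → H} {g : ℝ → Y}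
    {g' : Y} {d : ℂ} {t : ℝ} (hf : ContinuousAt f t) (hg : HasDerivAt g g' t)
    (hd : HasDerivAt (fun r => B (f r) (g t)) d t) :
    HasDerivAt (fun r => B (f r) (g r)) (d + B (f t) g') t := by
  -- Splitting `g r = g t + (g r - g t)` leaves only a term whose difference quotient falls entirely
  -- on `g`, so continuity of `f` suffices.
  have h1 : HasDerivAt (fun r => B (f r) (g r - g t)) (B (f t) g') t := by
    rw [hasDerivAt_iff_tendsto_slope] at hg ⊢
    have h2 : Tendsto (fun r => B (f r) (slope g t r)) (𝓝[≠] t) (𝓝 (B (f t) g')) :=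
      ((isBoundedBilinearMap_apply (𝕜 := ℂ) (E := Y) (F := ℂ)).continuous.tendsto
        (B (f t), g')).comp
        (((B.continuous.tendsto _).comp (hf.tendsto.mono_left nhdsWithin_le_nhds)).prodMk_nhds hg)
    refine h2.congr fun r => ?_
    rw [slope_def_module, slope_def_module]
    simp
  refine (hd.add h1).congr_of_eventuallyEq (Eventually.of_forall fun r => ?_)
  simp

/-! ### The matrix exponential of the symbol. -/

section Semigroup

variable {n N : ℕ}

/-- The algebra of operators on vectors of moments. -/
abbrev MomentOp (n N : ℕ) : Type := (MultiIdx n N → ℂ) →L[ℂ] (MultiIdx n N → ℂ)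

/-- A matrix as a continuous linear map. -/
def matrixOp (A : Matrix (MultiIdx n N) (MultiIdx n N) ℂ) : MomentOp n N :=
  LinearMap.toContinuousLinearMap (Matrix.mulVecLin A)

theorem matrixOp_apply (A : Matrix (MultiIdx n N) (MultiIdx n N) ℂ) (v : MultiIdx n N → ℂ) :
    matrixOp A v = A.mulVec v := rfl

/-- The operator governing the Fourier mode `ξ`. -/
def symbolOp (n N : ℕ) (ξ : Space n) : MomentOp n N :=
  matrixOp (symbolMatrix n N ((2 * Real.pi) • ξ))

theorem symbolOp_eq (ξ : Space n) :
    symbolOp n N ξ = ∑ j, (Complex.I * (((2 * Real.pi) * ξ j : ℝ) : ℂ)) •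
      matrixOp (transportMatrix n N j) + matrixOp (collisionMatrix n N) := by
  ext v β
  simp [symbolOp, symbolMatrix, matrixOp_apply, Matrix.add_mulVec, Matrix.sum_mulVec,
    Matrix.smul_mulVec, sum_apply]

theorem contDiff_symbolOp : ContDiff ℝ ∞ (symbolOp n N) := by
  have h : symbolOp n N = fun ξ => ∑ j, (Complex.I * (((2 * Real.pi) * ξ j : ℝ) : ℂ)) •
      matrixOp (transportMatrix n N j) + matrixOp (collisionMatrix n N) := funext symbolOp_eq
  rw [h]
  refine ContDiff.add (ContDiff.sum fun j _ => ContDiff.fun_smul ?_ contDiff_const) contDiff_const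
  refine contDiff_const.mul (Complex.ofRealCLM.contDiff.comp (contDiff_const.mul ?_))
  exact (EuclideanSpace.proj j : Space n →L[ℝ] ℝ).contDiff

theorem contDiff_momentOp_exp :
    ContDiff ℝ ∞ (NormedSpace.exp : MomentOp n N → MomentOp n N) := by
  have h : ContDiff ℂ ∞ (NormedSpace.exp : MomentOp n N → MomentOp n N) :=
    contDiff_iff_contDiffAt.2 fun x => (NormedSpace.exp_analytic (𝕂 := ℂ) x).contDiffAt
  exact h.restrict_scalars ℝ

/-- The flow `exp(u M(ξ))` of the Fourier mode `ξ`. -/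
def flow (n N : ℕ) (u : ℝ) (ξ : Space n) : MomentOp n N :=
  NormedSpace.exp ((u : ℂ) • symbolOp n N ξ)

theorem contDiff_flow (u : ℝ) : ContDiff ℝ ∞ (flow n N u) :=
  contDiff_momentOp_exp.comp (contDiff_const.fun_smul contDiff_symbolOp)

theorem hasDerivAt_exp_ofReal_smul {A : Type*} [NormedRing A] [NormedAlgebra ℂ A]
    [CompleteSpace A] [NormedSpace ℝ A] [IsScalarTower ℝ ℂ A] (x : A) (u : ℝ) :
    HasDerivAt (fun u : ℝ => NormedSpace.exp ((u : ℂ) • x))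
      (x * NormedSpace.exp ((u : ℂ) • x)) u := by
  have h := (hasDerivAt_exp_smul_const' (𝕂 := ℂ) x (u : ℂ)).scomp u
    (Complex.ofRealCLM.hasDerivAt)
  simpa using! h

theorem hasDerivAt_flow_neg_apply (ξ : Space n) (v : MultiIdx n N → ℂ) (t : ℝ) :
    HasDerivAt (fun t => flow n N (-t) ξ v)
      (-(symbolMatrix n N ((2 * Real.pi) • ξ)).mulVec (flow n N (-t) ξ v)) t := by
  have h1 : HasDerivAt (fun t => flow n N (-t) ξ) (-(symbolOp n N ξ * flow n N (-t) ξ)) t :=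
    ((hasDerivAt_exp_ofReal_smul (symbolOp n N ξ) (-t)).scomp t (hasDerivAt_neg t)).congr_deriv
      (by rw [neg_one_smul, flow])
  have h3 := ((ContinuousLinearMap.apply ℂ (MultiIdx n N → ℂ) v).restrictScalars ℝ).hasFDerivAt
    |>.comp_hasDerivAt t h1
  simpa using! h3

end Semigroup

/-! ### Weak solutions coincide with the matrix exponential. -/

section Identification

variable {n N : ℕ} {F : Space n → L2w n}
  {m : ℝ → MultiIdx n N → Lp ℂ 2 (volume : Measure (Space n))}

open scoped SchwartzMap

theorem memLp_bcf_mul {ψ : Space n → ℂ} (hψ : MemLp ψ 2) (g : Space n →ᵇ ℂ) :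
    MemLp (fun ξ => g ξ * ψ ξ) 2 volume :=
  hψ.of_le_mul (c := ‖g‖) (g.continuous.aestronglyMeasurable.mul hψ.aestronglyMeasurable)
    (ae_of_all _ fun ξ => by
      rw [norm_mul]
      exact mul_le_mul_of_nonneg_right (g.norm_coe_le_norm ξ) (norm_nonneg _))

theorem norm_integral_bcf_le {ψ : Space n → ℂ} (hψ : MemLp ψ 2)
    (f : Lp ℂ 2 (volume : Measure (Space n))) (g : Space n →ᵇ ℂ) :
    ‖∫ ξ, f ξ * (g ξ * ψ ξ)‖ ≤ (eLpNorm ψ 2 volume).toReal * ‖f‖ * ‖g‖ := by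
  refine (norm_integral_lp_mul_le f (memLp_bcf_mul hψ g)).trans ?_
  have h1 : eLpNorm (fun ξ => g ξ * ψ ξ) 2 volume ≤ ENNReal.ofReal ‖g‖ * eLpNorm ψ 2 volume :=
    eLpNorm_le_mul_eLpNorm_of_ae_le_mul (ae_of_all _ fun ξ => by
      rw [norm_mul]
      exact mul_le_mul_of_nonneg_right (g.norm_coe_le_norm ξ) (norm_nonneg _)) 2
  have h2 := ENNReal.toReal_mono (ENNReal.mul_ne_top ENNReal.ofReal_ne_top hψ.eLpNorm_ne_top) h1
  rw [ENNReal.toReal_mul, ENNReal.toReal_ofReal (norm_nonneg _)] at h2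
  calc _ ≤ ‖f‖ * (‖g‖ * (eLpNorm ψ 2 volume).toReal) :=
        mul_le_mul_of_nonneg_left h2 (norm_nonneg _)
    _ = _ := by ring

/-- The pairing `(f, g) ↦ ∫ f g ψ`. -/
def testPairing {ψ : Space n → ℂ} (hψ : MemLp ψ 2) :
    Lp ℂ 2 (volume : Measure (Space n)) →L[ℂ] (Space n →ᵇ ℂ) →L[ℂ] ℂ :=
  LinearMap.mkContinuous₂
    (LinearMap.mk₂ ℂ (fun f g => ∫ ξ, f ξ * (g ξ * ψ ξ))
      (fun f f' g => by
        rw [← integral_add (integrable_lp_mul f (memLp_bcf_mul hψ g))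
          (integrable_lp_mul f' (memLp_bcf_mul hψ g))]
        refine integral_congr_ae ?_
        filter_upwards [Lp.coeFn_add f f'] with ξ h
        rw [h, Pi.add_apply, add_mul])
      (fun c f g => by
        rw [smul_eq_mul, ← integral_const_mul]
        refine integral_congr_ae ?_
        filter_upwards [Lp.coeFn_smul c f] with ξ h
        rw [h, Pi.smul_apply, smul_eq_mul, mul_assoc])
      (fun f g g' => by
        rw [← integral_add (integrable_lp_mul f (memLp_bcf_mul hψ g))
          (integrable_lp_mul f (memLp_bcf_mul hψ g'))]
        refine integral_congr_ae (ae_of_all _ fun ξ => ?_)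
        simp only [BoundedContinuousFunction.add_apply]
        ring)
      (fun c f g => by
        rw [smul_eq_mul, ← integral_const_mul]
        refine integral_congr_ae (ae_of_all _ fun ξ => ?_)
        simp only [BoundedContinuousFunction.smul_apply, smul_eq_mul]
        ring))
    (eLpNorm ψ 2 volume).toReal (fun f g => norm_integral_bcf_le hψ f g)

theorem testPairing_apply {ψ : Space n → ℂ} (hψ : MemLp ψ 2)
    (f : Lp ℂ 2 (volume : Measure (Space n))) (g : Space n →ᵇ ℂ) :
    testPairing hψ f g = ∫ ξ, f ξ * (g ξ * ψ ξ) := rfl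

/-- The matrix entry `(γ, α)` of an operator. -/
def entryCLM (γ α : MultiIdx n N) : MomentOp n N →L[ℂ] ℂ :=
  (ContinuousLinearMap.proj (R := ℂ) (φ := fun _ : MultiIdx n N => ℂ) γ).comp
    (ContinuousLinearMap.apply ℂ (MultiIdx n N → ℂ) (Pi.single α 1))

theorem entryCLM_apply (γ α : MultiIdx n N) (e : MomentOp n N) :
    entryCLM γ α e = e (Pi.single α 1) γ := rfl

theorem momentOp_apply (e : MomentOp n N) (v : MultiIdx n N → ℂ) (γ : MultiIdx n N) :
    e v γ = ∑ α, v α * entryCLM γ α e := by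
  have h : v = ∑ α, v α • (Pi.single α 1 : MultiIdx n N → ℂ) := by
    ext β
    simp [Finset.sum_apply, Pi.single_apply]
  conv_lhs => rw [h, map_sum, Finset.sum_apply]
  simp [entryCLM_apply]

theorem entryCLM_mul (γ α : MultiIdx n N) (e e' : MomentOp n N) :
    entryCLM γ α (e * e') = ∑ β, entryCLM β α e' * entryCLM γ β e := by
  rw [entryCLM_apply, mul_apply_eq_comp, momentOp_apply]
  rfl

theorem entryCLM_symbolOp (γ α : MultiIdx n N) (ξ : Space n) :
    entryCLM γ α (symbolOp n N ξ) = symbolMatrix n N ((2 * Real.pi) • ξ) γ α := by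
  rw [entryCLM_apply, symbolOp, matrixOp_apply, Matrix.mulVec_single_one]
  rfl

/-- The symbol is unbounded in `ξ`. A bump equal to 1 on the support of `ψ` makes it an element of
the Banach algebra of bounded continuous functions without affecting integrals against `ψ`. -/
theorem exists_bcf_symbolOp {ψ : Space n → ℂ} (hc : HasCompactSupport ψ) :
    ∃ M : Space n →ᵇ MomentOp n N, ContDiff ℝ ∞ M ∧ ∀ ξ, ψ ξ ≠ 0 → M ξ = symbolOp n N ξ := by
  obtain ⟨R, hR⟩ := hc.isCompact.isBounded.subset_closedBall (0 : Space n)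
  let b : ContDiffBump (0 : Space n) := ⟨max R 1, max R 1 + 1, by positivity, by linarith⟩
  have hd : ContDiff ℝ ∞ fun ξ => (b ξ) • symbolOp n N ξ :=
    b.contDiff.fun_smul contDiff_symbolOp
  obtain ⟨K, hK⟩ := hd.continuous.bounded_above_of_compact_support
    (b.hasCompactSupport.smul_right (f' := symbolOp n N))
  refine ⟨BoundedContinuousFunction.ofNormedAddCommGroup _ hd.continuous K hK, hd, fun ξ hξ => ?_⟩
  have h1 : ξ ∈ Metric.closedBall (0 : Space n) b.rIn :=
    Metric.closedBall_subset_closedBall (le_max_left _ _)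
      (hR (subset_tsupport _ (Function.mem_support.2 hξ)))
  change b ξ • symbolOp n N ξ = _
  rw [b.one_of_mem_closedBall h1, one_smul]

/-- Evaluation at a point is a continuous ring homomorphism, hence commutes with the exponential
series. -/
theorem bcf_exp_apply {X A : Type*} [TopologicalSpace X] [NormedRing A] [NormedAlgebra ℂ A]
    [CompleteSpace A] (M : X →ᵇ A) (x : X) :
    (NormedSpace.exp M : X →ᵇ A) x = NormedSpace.exp (M x) := by
  let _ : NormedAlgebra ℚ (X →ᵇ A) := NormedAlgebra.restrictScalars ℚ ℂ _
  let _ : NormedAlgebra ℚ A := NormedAlgebra.restrictScalars ℚ ℂ _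
  let ev : (X →ᵇ A) →+* A :=
    { toFun := fun f => f x
      map_one' := rfl
      map_mul' := fun _ _ => rfl
      map_zero' := rfl
      map_add' := fun _ _ => rfl }
  exact NormedSpace.map_exp ev (continuous_eval_const x) _

/-- The functions `x ↦ φ (exp(u M(x)))`, for functionals `φ`, are differentiable in `u`
uniformly in `x`. -/
theorem exists_bcf_exp {X A ι : Type*} [TopologicalSpace X] [NormedRing A] [NormedAlgebra ℂ A]
    [CompleteSpace A] (M : X →ᵇ A) (φ : ι → A →L[ℂ] ℂ) :
    ∃ g g' : ι → ℝ → (X →ᵇ ℂ),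
      (∀ i u x, g i u x = φ i (NormedSpace.exp ((u : ℂ) • M x))) ∧
      (∀ i u x, g' i u x = φ i (NormedSpace.exp ((u : ℂ) • M x) * M x)) ∧
      ∀ i u, HasDerivAt (g i) (g' i u) u := by
  refine ⟨fun i u => (φ i).compLeftContinuousBounded X (NormedSpace.exp ((u : ℂ) • M)),
    fun i u => (φ i).compLeftContinuousBounded X (NormedSpace.exp ((u : ℂ) • M) * M),
    fun i u x => ?_, fun i u x => ?_, fun i u => ?_⟩
  · exact congrArg (φ i) (bcf_exp_apply ((u : ℂ) • M) x)
  · exact congrArg (fun z => φ i (z * M x)) (bcf_exp_apply ((u : ℂ) • M) x)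
  · have h := (((φ i).compLeftContinuousBounded X).hasFDerivAt.comp_hasDerivAt (u : ℂ)
      (hasDerivAt_exp_smul_const (𝕂 := ℂ) M (u : ℂ))).scomp u Complex.ofRealCLM.hasDerivAt
    simpa using! h

theorem exp_zero_smul {A : Type*} [NormedRing A] [NormedAlgebra ℂ A] (x : A) :
    NormedSpace.exp ((0 : ℂ) • x) = 1 := by
  rw [zero_smul, NormedSpace.exp_zero]

theorem continuousOn_lpHat (hm : IsGalerkinSolution N F m) (α : MultiIdx n N) :
    ContinuousOn (fun r => lpHat (m r α)) (Ici 0) :=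
  (Lp.fourierTransformₗᵢ (Space n) ℂ).continuous.comp_continuousOn
    ((continuous_apply α).comp_continuousOn hm.continuousOn)

/-- Duality: pair the solution at time `r` with row `γ` of `exp((r-T)M)` times `ψ`. The two
derivatives in `r` cancel, and equality of the values at `r = T` and `r = 0` is the claim. -/
theorem integral_lpHat_eq (hm : IsGalerkinSolution N F m) {T : ℝ} (hT : 0 ≤ T)
    (γ : MultiIdx n N) {ψ : Space n → ℂ} (hψ : ContDiff ℝ ∞ ψ) (hc : HasCompactSupport ψ) :
    ∫ ξ, lpHat (m T γ) ξ * ψ ξ =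
      ∑ α, ∫ ξ, lpHat (m 0 α) ξ * (entryCLM γ α (flow n N (-T) ξ) * ψ ξ) := by
  have hψ2 : MemLp ψ 2 volume := hψ.continuous.memLp_of_hasCompactSupport hc
  obtain ⟨M, hM, hMψ⟩ := exists_bcf_symbolOp (N := N) hc
  obtain ⟨e, d, he, hd, hed⟩ := exists_bcf_exp M (entryCLM γ)
  -- The shift by `T` makes the exponential the identity at `r = T`, so that only the component `γ`
  -- survives there.
  let g : MultiIdx n N → ℝ → (Space n →ᵇ ℂ) := fun α r => e α (r - T)
  have hg : ∀ α r ξ, g α r ξ = entryCLM γ α (NormedSpace.exp (((r - T : ℝ) : ℂ) • M ξ)) :=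
    fun α r ξ => he α (r - T) ξ
  let g' : MultiIdx n N → ℝ → (Space n →ᵇ ℂ) := fun α r => d α (r - T)
  have hg' : ∀ α r ξ, g' α r ξ = ∑ β, entryCLM β α (M ξ) * g β r ξ := by
    intro α r ξ
    simp only [hg]
    exact (hd α (r - T) ξ).trans (entryCLM_mul γ α _ _)
  have hgd : ∀ α r, HasDerivAt (g α) (g' α r) r := fun α r =>
    (hed α (r - T)).comp_sub_const r T
  have hgs : ∀ α r, ContDiff ℝ ∞ fun ξ => g α r ξ * ψ ξ := by
    intro α r
    refine ContDiff.mul ?_ hψ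
    have h1 : (g α r : Space n → ℂ) =
        fun ξ => entryCLM γ α (NormedSpace.exp (((r - T : ℝ) : ℂ) • M ξ)) := funext (hg α r)
    rw [h1]
    exact ((entryCLM γ α).restrictScalars ℝ).contDiff.comp
      (contDiff_momentOp_exp.comp (contDiff_const.fun_smul hM))
  have hgc : ∀ α r, HasCompactSupport fun ξ => g α r ξ * ψ ξ := fun α r => hc.mul_left
  let p : ℝ → ℂ := fun r => ∑ α, testPairing hψ2 (lpHat (m r α)) (g α r)
  have hp : ∀ t ∈ Ioo 0 T, HasDerivAt p 0 t := by
    intro t ht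
    have h1 : ∀ α ∈ (Finset.univ : Finset (MultiIdx n N)),
        HasDerivAt (fun r => testPairing hψ2 (lpHat (m r α)) (g α r))
        ((-∑ β, ∫ ξ, lpHat (m t β) ξ * (symbolMatrix n N ((2 * Real.pi) • ξ) α β *
          (g α t ξ * ψ ξ))) + testPairing hψ2 (lpHat (m t α)) (g' α t)) t := by
      intro α _
      refine hasDerivAt_bilinear_of_weak (testPairing hψ2)
        ((continuousOn_lpHat hm α).continuousAt (Ici_mem_nhds ht.1)) (hgd α t) ?_
      exact weak_fourier hm ((hgc α t).toSchwartzMap (hgs α t)) α ht.1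
    refine (HasDerivAt.fun_sum h1).congr_deriv ?_
    rw [Finset.sum_add_distrib, Finset.sum_neg_distrib, neg_add_eq_zero, Finset.sum_comm]
    refine Finset.sum_congr rfl fun β _ => ?_
    rw [testPairing_apply]
    have hent : ∀ α ξ, symbolMatrix n N ((2 * Real.pi) • ξ) α β * (g α t ξ * ψ ξ) =
        ((entryCLM α β).compLeftContinuousBounded (Space n) M * g α t) ξ * ψ ξ := by
      intro α ξ
      rw [BoundedContinuousFunction.mul_apply]
      change _ = entryCLM α β (M ξ) * g α t ξ * ψ ξ
      by_cases h0 : ψ ξ = 0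
      · simp [h0]
      · rw [hMψ ξ h0, entryCLM_symbolOp]
        ring
    simp only [hent]
    rw [← integral_finsetSum]
    · refine integral_congr_ae (ae_of_all _ fun ξ => ?_)
      simp only [BoundedContinuousFunction.mul_apply]
      rw [hg', Finset.sum_mul, Finset.mul_sum]
      rfl
    · intro α _
      exact integrable_lp_mul _ (memLp_bcf_mul hψ2 _)
  have hpc : ContinuousOn p (Icc 0 T) := by
    refine continuousOn_finsetSum _ fun α _ => ?_
    exact ((testPairing hψ2).continuous.comp_continuousOn
      ((continuousOn_lpHat hm α).mono Icc_subset_Ici_self)).clm_apply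
      (continuous_iff_continuousAt.2 fun r => (hgd α r).continuousAt).continuousOn
  -- The derivative is known only in the interior; continuity on the closed interval reaches the
  -- initial time.
  have hconst := intervalIntegral.integral_eq_sub_of_hasDerivAt_of_le hT hpc hp (by simp)
  rw [intervalIntegral.integral_zero] at hconst
  have hgT : ∀ α ξ, g α T ξ = if γ = α then 1 else 0 := by
    intro α ξ
    rw [hg, sub_self, Complex.ofReal_zero]
    refine (congrArg (entryCLM γ α) (exp_zero_smul (M ξ))).trans ?_
    exact Pi.single_apply α 1 γ
  have hpT : p T = ∫ ξ, lpHat (m T γ) ξ * ψ ξ := by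
    change ∑ α, testPairing hψ2 (lpHat (m T α)) (g α T) = _
    simp only [testPairing_apply, hgT]
    rw [Finset.sum_eq_single γ]
    · simp
    · intro α _ hα
      simp [Ne.symm hα]
    · simp
  rw [← hpT, sub_eq_zero.1 hconst.symm]
  refine Finset.sum_congr rfl fun α _ => ?_
  rw [testPairing_apply]
  refine integral_congr_ae (ae_of_all _ fun ξ => ?_)
  by_cases h0 : ψ ξ = 0
  · simp [h0]
  · simp only [hg, flow]
    rw [hMψ ξ h0, zero_sub]

end Identification

/-! ### Bounds for the solution on the Fourier side and their inversion. -/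

section Bounds

variable {n N : ℕ} {F G : Space n → L2w n}
  {m : ℝ → MultiIdx n N → Lp ℂ 2 (volume : Measure (Space n))}

/-- The Fourier transform of a Galerkin solution evolves by the flow of the symbol. -/
theorem lpHat_ae_eq_flow (hm : IsGalerkinSolution N F m) {T : ℝ} (hT : 0 ≤ T) :
    ∀ᵐ ξ, ∀ γ, lpHat (m T γ) ξ = flow n N (-T) ξ (fun α => lpHat (m 0 α) ξ) γ := by
  rw [ae_all_iff]
  intro γ
  simp only [momentOp_apply]
  have hcont : ∀ α, ContDiff ℝ ∞ fun ξ => entryCLM γ α (flow n N (-T) ξ) := fun α =>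
    ((entryCLM γ α).restrictScalars ℝ).contDiff.comp (contDiff_flow (-T))
  refine ae_eq_of_integral_mul_eq (locallyIntegrable_lp _)
    (locallyIntegrable_finsetSum _ fun α _ =>
      (locallyIntegrable_lp _).mul_continuous (hcont α).continuous) fun φ hφ hc => ?_
  rw [integral_lpHat_eq hm hT γ hφ hc, ← integral_finsetSum]
  · refine integral_congr_ae (ae_of_all _ fun ξ => ?_)
    simp only [Finset.sum_mul, mul_assoc]
  · intro α _
    exact integrable_lp_mul _ (((hcont α).mul hφ).continuous.memLp_of_hasCompactSupport
      hc.mul_left)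

/-- The initial moments lie in `L¹ ∩ L²`, so the `L²` transform is the integral one and commutes
with taking moments. -/
theorem lpHat_zero_ae_eq (hm : IsGalerkinSolution N F m) (hF : Integrable F) :
    ∀ᵐ ξ, ∀ γ, lpHat (m 0 γ) ξ = moment γ.1 (𝓕 F ξ) := by
  rw [ae_all_iff]
  intro γ
  have h1 : Integrable (m 0 γ) := (integrable_moment hF γ.1).congr (hm.initial γ).symm
  filter_upwards [lpFourier_ae_eq h1] with ξ hξ
  rw [lpHat, hξ, Real.fourier_congr_ae (hm.initial γ), fourier_moment hF]

/-- The symbol of `⟨D⟩^{-s}`. -/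
def japaneseWeight (s κ : ℝ) : ℝ := (1 + κ ^ 2) ^ (-s / 2)

theorem norm_fourier_le_japaneseWeight {s : ℝ} (h : IsJapaneseDeriv s F G) (ξ : Space n) :
    ‖𝓕 F ξ‖ ≤ japaneseWeight s (2 * Real.pi * ‖ξ‖) * ∫ x, ‖G x‖ := by
  have hp : 0 < 1 + (2 * Real.pi * ‖ξ‖) ^ 2 := by positivity
  have h1 : ‖𝓕 G ξ‖ ≤ ∫ x, ‖G x‖ := VectorFourier.norm_fourierIntegral_le_integral_norm _ _ _ _ _
  rw [h.fourier_eq, norm_smul, Complex.norm_real,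
    Real.norm_of_nonneg (Real.rpow_pos_of_pos hp _).le] at h1
  calc ‖𝓕 F ξ‖ = japaneseWeight s (2 * Real.pi * ‖ξ‖) *
        ((1 + (2 * Real.pi * ‖ξ‖) ^ 2) ^ (s / 2) * ‖𝓕 F ξ‖) := by
        rw [japaneseWeight, ← mul_assoc, ← Real.rpow_add hp]
        rw [show -s / 2 + s / 2 = 0 by ring, Real.rpow_zero, one_mul]
    _ ≤ _ := mul_le_mul_of_nonneg_left h1 (Real.rpow_pos_of_pos hp _).le

/-- Mode decay, Bessel's inequality and the Sobolev bound on `𝓕 F` combine, each with a constant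
independent of `N`. The rate is halved because `weightSq` is the square of the norm. -/
theorem norm_weightVec_lpHat_le (hn : 0 < n) (hN : 1 ≤ N) {s : ℝ} (h : IsJapaneseDeriv s F G)
    (hm : IsGalerkinSolution N F m) {t : ℝ} (ht : 0 ≤ t) :
    ∀ᵐ ξ, ‖weightVec fun α => lpHat (m t α) ξ‖ ≤
      Real.sqrt 3 * Real.exp (-decayRate n (2 * Real.pi * ‖ξ‖) / 2 * t) *
        japaneseWeight s (2 * Real.pi * ‖ξ‖) * ∫ x, ‖G x‖ := by
  filter_upwards [lpHat_ae_eq_flow hm ht, lpHat_zero_ae_eq hm h.integrable_left] with ξ h1 h2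
  have h3 : (fun α => lpHat (m 0 α) ξ) = fun γ : MultiIdx n N => moment γ.1 (𝓕 F ξ) := funext h2
  have h4 : (fun α => lpHat (m t α) ξ) =
      flow n N (-t) ξ (fun γ : MultiIdx n N => moment γ.1 (𝓕 F ξ)) := by
    rw [← h3]
    exact funext h1
  have h5 := weightSq_decay hn hN (k := (2 * Real.pi) • ξ)
    (hasDerivAt_flow_neg_apply ξ (fun γ : MultiIdx n N => moment γ.1 (𝓕 F ξ))) ht
  have h6 : flow n N (-0) ξ (fun γ : MultiIdx n N => moment γ.1 (𝓕 F ξ)) =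
      fun γ : MultiIdx n N => moment γ.1 (𝓕 F ξ) := by
    rw [flow, neg_zero, Complex.ofReal_zero]
    exact congrArg (fun e : MomentOp n N => e _) (exp_zero_smul (symbolOp n N ξ))
  have h7 : ‖(2 * Real.pi) • ξ‖ = 2 * Real.pi * ‖ξ‖ := by
    rw [norm_smul, Real.norm_of_nonneg (by positivity)]
  rw [h6, h7] at h5
  have h8 := weightSq_moment_le (N := N) (𝓕 F ξ)
  rw [h4, norm_weightVec]
  have h9 : Real.sqrt (weightSq (flow n N (-t) ξ fun γ : MultiIdx n N => moment γ.1 (𝓕 F ξ))) ≤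
      Real.sqrt 3 * Real.exp (-decayRate n (2 * Real.pi * ‖ξ‖) / 2 * t) * ‖𝓕 F ξ‖ := by
    refine Real.sqrt_le_iff.2 ⟨by positivity, h5.trans ?_⟩
    rw [mul_pow, mul_pow, Real.sq_sqrt (by norm_num), ← Real.exp_nat_mul]
    rw [show ((2 : ℕ) : ℝ) * (-decayRate n (2 * Real.pi * ‖ξ‖) / 2 * t) =
      -decayRate n (2 * Real.pi * ‖ξ‖) * t by push_cast; ring]
    exact mul_le_mul_of_nonneg_left h8 (by positivity)
  refine h9.trans ?_
  rw [mul_assoc (Real.sqrt 3 * _)]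
  exact mul_le_mul_of_nonneg_left (norm_fourier_le_japaneseWeight h ξ) (by positivity)

/-- `weightVec` as a continuous linear map. -/
def weightCLM (n N : ℕ) : (MultiIdx n N → ℂ) →L[ℂ] EuclideanSpace ℂ (MultiIdx n N) :=
  LinearMap.toContinuousLinearMap
    { toFun := weightVec
      map_add' := fun y z => by ext β; simp [weightVec, mul_add]
      map_smul' := fun c y => by ext β; simp [weightVec, mul_left_comm] }

theorem weightCLM_apply (y : MultiIdx n N → ℂ) : weightCLM n N y = weightVec y := rfl

theorem norm_apply_le_weightVec (y : MultiIdx n N → ℂ) (α : MultiIdx n N) :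
    ‖y α‖ ≤ Real.sqrt (multiFactorial α.1) * ‖weightVec y‖ := by
  have h1 := PiLp.norm_apply_le (weightVec y) α
  have h2 := Real.sqrt_pos.2 (multiFactorial_pos α.1)
  rw [weightVec] at h1
  simp only [norm_mul, norm_inv, Complex.norm_real, Real.norm_of_nonneg h2.le] at h1
  rwa [inv_mul_le_iff₀ h2] at h1

/-- An integrable majorant on the Fourier side bounds the solution uniformly. -/
theorem norm_weightVec_le_integral {v : MultiIdx n N → Lp ℂ 2 (volume : Measure (Space n))}
    {b : Space n → ℝ} (hb : Integrable b)
    (h : ∀ᵐ ξ, ‖weightVec fun α => lpHat (v α) ξ‖ ≤ b ξ) :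
    ∀ᵐ x, ‖weightVec fun α => v α x‖ ≤ ∫ ξ, b ξ := by
  have hint : ∀ α, Integrable (lpHat (v α)) := fun α => by
    refine (hb.const_mul (Real.sqrt (multiFactorial α.1))).mono'
      (Lp.aestronglyMeasurable _) ?_
    filter_upwards [h] with ξ hξ
    exact (norm_apply_le_weightVec (fun α => lpHat (v α) ξ) α).trans
      (mul_le_mul_of_nonneg_left hξ (Real.sqrt_nonneg _))
  have hinv : ∀ᵐ x, ∀ α, v α x = 𝓕⁻ (lpHat (v α) : Space n → ℂ) x :=
    ae_all_iff.2 fun α => ae_eq_fourierInv (hint α)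
  filter_upwards [hinv] with x hx
  have hi : ∀ α, Integrable fun ξ => Real.fourierChar (inner ℝ ξ x) • lpHat (v α) ξ := fun α => by
    have h0 := (Real.fourierIntegral_convergent_iff (-x)).2 (hint α)
    simpa using! h0
  -- Inverting the whole vector at once puts its Euclidean norm under the integral; treating
  -- components separately would lose a factor depending on `N`.
  have h1 : (fun α => v α x) = ∫ ξ, fun α => Real.fourierChar (inner ℝ ξ x) • lpHat (v α) ξ := by
    ext α
    rw [eval_integral hi, hx α, Real.fourierInv_eq]
  rw [h1, ← weightCLM_apply, ← ContinuousLinearMap.integral_comp_comm _ (Integrable.of_eval hi)]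
  refine norm_integral_le_of_norm_le hb ?_
  filter_upwards [h] with ξ hξ
  have h2 : (fun α => Real.fourierChar (inner ℝ ξ x) • lpHat (v α) ξ) =
      Real.fourierChar (inner ℝ ξ x) • fun α => lpHat (v α) ξ := rfl
  rw [h2, Circle.smul_def, map_smul, norm_smul, Circle.norm_coe, one_mul, weightCLM_apply]
  exact hξ

end Bounds

/-! ### The decay estimate -/

theorem crossConst_pos {n : ℕ} (hn : 0 < n) : 0 < crossConst n := by
  rw [crossConst]
  have : (0 : ℝ) < n := Nat.cast_pos.2 hn
  positivity

/-- Low frequencies are bounded by a heat kernel, high frequencies decay exponentially. -/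
theorem exp_decayRate_mul_le {n : ℕ} (hn : 0 < n) {κ J t : ℝ} (hJ0 : 0 ≤ J)
    (hJ1 : J ≤ 1) (ht : 0 ≤ t) :
    Real.exp (-decayRate n κ / 2 * t) * J ≤
      Real.exp (crossConst n / 12) * Real.exp (-(crossConst n / 12 * (1 + t)) * κ ^ 2) +
        Real.exp (-(crossConst n / 12) * t) * J := by
  have hδ := crossConst_pos hn
  have hk2 : 0 ≤ κ ^ 2 := sq_nonneg κ
  rcases le_total (κ ^ 2) 1 with h | h
  · have h1 : κ ^ 2 / 2 ≤ κ ^ 2 / (1 + κ ^ 2) :=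
      div_le_div_of_nonneg_left hk2 (by positivity) (by linarith)
    -- With `δ = crossConst n`, the half rate is at least `δκ²/12`; replacing `t` by `1+t` costs at
    -- most `δ/12` because `κ² ≤ 1`.
    have h2 : -decayRate n κ / 2 * t ≤
        crossConst n / 12 + -(crossConst n / 12 * (1 + t)) * κ ^ 2 := by
      have h3 : crossConst n / 3 * (κ ^ 2 / 2) ≤ decayRate n κ :=
        mul_le_mul_of_nonneg_left h1 (by positivity)
      have h4 := mul_le_mul_of_nonneg_right h3 ht
      have h5 : crossConst n * κ ^ 2 ≤ crossConst n * 1 := mul_le_mul_of_nonneg_left h hδ.le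
      nlinarith
    rw [← Real.exp_add]
    refine le_add_of_le_of_nonneg ?_ (by positivity)
    exact (mul_le_of_le_one_right (Real.exp_pos _).le hJ1).trans (Real.exp_le_exp.2 h2)
  · have h1 : 1 / 2 ≤ κ ^ 2 / (1 + κ ^ 2) := by
      rw [div_le_div_iff₀ (by norm_num) (by positivity)]
      linarith
    refine le_add_of_nonneg_of_le (by positivity)
      (mul_le_mul_of_nonneg_right (Real.exp_le_exp.2 ?_) hJ0)
    have h3 : crossConst n / 3 * (1 / 2) ≤ decayRate n κ :=
      mul_le_mul_of_nonneg_left h1 (by positivity)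
    have h4 := mul_le_mul_of_nonneg_right h3 ht
    linarith

/-- The majorant of the Fourier modes, up to the factor `√3 ‖G‖_{L¹}`. -/
def majorant (n : ℕ) (s t : ℝ) (ξ : Space n) : ℝ :=
  Real.exp (crossConst n / 12) * Real.exp (-(crossConst n / 12 * (1 + t)) * ‖ξ‖ ^ 2) +
    Real.exp (-(crossConst n / 12) * t) * (1 + ‖ξ‖ ^ 2) ^ (-s / 2)

/-- Both terms of the bound decrease in the frequency, so `2π‖ξ‖` may be replaced by the smaller
`‖ξ‖`. -/
theorem exp_mul_japaneseWeight_le {n : ℕ} (hn : 0 < n) {s t : ℝ} (hs : 0 < s) (ht : 0 ≤ t)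
    (ξ : Space n) :
    Real.exp (-decayRate n (2 * Real.pi * ‖ξ‖) / 2 * t) * japaneseWeight s (2 * Real.pi * ‖ξ‖) ≤
      majorant n s t ξ := by
  have hδ := crossConst_pos hn
  have h0 : ‖ξ‖ ^ 2 ≤ (2 * Real.pi * ‖ξ‖) ^ 2 := by
    refine pow_le_pow_left₀ (norm_nonneg _) ?_ 2
    exact le_mul_of_one_le_left (norm_nonneg _) (by linarith [Real.pi_gt_three])
  have hJ0 : 0 ≤ japaneseWeight s (2 * Real.pi * ‖ξ‖) := Real.rpow_nonneg (by positivity) _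
  have hJ1 : japaneseWeight s (2 * Real.pi * ‖ξ‖) ≤ 1 :=
    Real.rpow_le_one_of_one_le_of_nonpos (by nlinarith [sq_nonneg (2 * Real.pi * ‖ξ‖)])
      (by linarith)
  refine (exp_decayRate_mul_le hn hJ0 hJ1 ht).trans (add_le_add ?_ ?_)
  · refine mul_le_mul_of_nonneg_left (Real.exp_le_exp.2 ?_) (Real.exp_pos _).le
    rw [neg_mul, neg_mul, neg_le_neg_iff]
    exact mul_le_mul_of_nonneg_left h0 (by positivity)
  · refine mul_le_mul_of_nonneg_left ?_ (Real.exp_pos _).le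
    exact Real.rpow_le_rpow_of_nonpos (by positivity) (by linarith) (by linarith)

theorem integral_gauss_space {n : ℕ} {c t : ℝ} (hc : 0 < c) (ht : 0 ≤ t) :
    ∫ ξ : Space n, Real.exp (-(c * (1 + t)) * ‖ξ‖ ^ 2) =
      (Real.pi / c) ^ ((n : ℝ) / 2) * (1 + t) ^ (-(n : ℝ) / 2) := by
  have h1 : 0 < 1 + t := by linarith
  rw [GaussianFourier.integral_rexp_neg_mul_sq_norm (by positivity), finrank_euclideanSpace_fin,
    ← div_div, div_eq_mul_inv (Real.pi / c), Real.mul_rpow (by positivity) (by positivity),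
    Real.inv_rpow h1.le, ← Real.rpow_neg h1.le, neg_div]

/-- The integral of a non-integrable function is `0` by convention, while the Gaussian formula gives
a positive value. -/
theorem integrable_gauss_space {n : ℕ} {b : ℝ} (hb : 0 < b) :
    Integrable fun ξ : Space n => Real.exp (-b * ‖ξ‖ ^ 2) := by
  refine Integrable.of_integral_ne_zero ?_
  rw [GaussianFourier.integral_rexp_neg_mul_sq_norm hb]
  positivity

theorem integrable_majorant {n : ℕ} (hn : 0 < n) {s t : ℝ} (hs : (n : ℝ) < s) (ht : 0 ≤ t) :
    Integrable (majorant n s t) := by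
  have hδ := crossConst_pos hn
  refine ((integrable_gauss_space (by positivity)).const_mul _).add
    ((integrable_rpow_neg_one_add_norm_sq ?_).const_mul _)
  rwa [finrank_euclideanSpace_fin]

theorem integral_majorant {n : ℕ} (hn : 0 < n) {s t : ℝ} (hs : (n : ℝ) < s) (ht : 0 ≤ t) :
    ∫ ξ, majorant n s t ξ =
      Real.exp (crossConst n / 12) * ((Real.pi / (crossConst n / 12)) ^ ((n : ℝ) / 2) *
        (1 + t) ^ (-(n : ℝ) / 2)) +
      Real.exp (-(crossConst n / 12) * t) * ∫ ξ : Space n, (1 + ‖ξ‖ ^ 2) ^ (-s / 2) := by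
  have hδ := crossConst_pos hn
  unfold majorant
  rw [integral_add ((integrable_gauss_space (by positivity)).const_mul _)
    ((integrable_rpow_neg_one_add_norm_sq (by rwa [finrank_euclideanSpace_fin])).const_mul _),
    integral_const_mul, integral_const_mul, integral_gauss_space (by positivity) ht]

/-- The system with `N = 0` is not dissipative. -/
theorem one_le_of_isStronglyStable {n N : ℕ} (hn : 0 < n)
    (h : IsStronglyStable (fpPolynomial n N)) : 1 ≤ N := by
  rw [Nat.one_le_iff_ne_zero]
  rintro rfl
  have hz : ∀ β : MultiIdx n 0, ∀ i, β.1 i = 0 := fun β i => by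
    have := (Finset.sum_eq_zero_iff.1 (Nat.le_zero.1 β.2)) i (Finset.mem_univ i)
    exact this
  have hA : ∀ j, transportMatrix n 0 j = 0 := by
    intro j
    ext β α
    rw [transportMatrix_apply, if_neg, if_neg]
    · simp
    · intro h'
      have := congrFun h' j
      simp [hz] at this
    · intro h'
      have := congrFun h' j
      simp [hz] at this
  have hB : collisionMatrix n 0 = 0 := by
    ext β α
    simp [collisionMatrix, Matrix.diagonal_apply, hz]
  let ξ : Space n := EuclideanSpace.single ⟨0, hn⟩ 1
  -- For `N = 0` the polynomial is just `τ`, so `τ = 0` is a real root at a nonzero frequency.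
  have hP : fpPolynomial n 0 0 ξ = 0 := by
    have : Nonempty (MultiIdx n 0) := ⟨zeroIdx n 0⟩
    simp [fpPolynomial, hA, hB, Matrix.det_zero]
  have h0 := (h.stable ξ 0 hP).2 rfl
  simp [ξ] at h0

end FokkerPlanck

end

theorem mainTheorem12 (n : ℕ) (hn : 0 < n) (s : ℝ) (hs : (n : ℝ) < s) :
    ∃ C : ℝ, 0 < C ∧ ∀ N : ℕ,
      FokkerPlanck.IsStronglyStable (FokkerPlanck.fpPolynomial n N) →
      ∃ C_N ε : ℝ, 0 < C_N ∧ 0 < ε ∧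
        ∀ (F G : FokkerPlanck.Space n → FokkerPlanck.L2w n),
          FokkerPlanck.IsJapaneseDeriv s F G →
          ∀ m : ℝ → FokkerPlanck.MultiIdx n N →
              Lp ℂ 2 (volume : Measure (FokkerPlanck.Space n)),
            FokkerPlanck.IsGalerkinSolution N F m →
            ∀ t : ℝ, 0 ≤ t →
              FokkerPlanck.mixedNorm (FokkerPlanck.velMeasure n)
                  (FokkerPlanck.galerkinApprox m t) ≤
                ENNReal.ofReal ((C * (1 + t) ^ (-(n : ℝ) / 2) + C_N * Real.exp (-ε * t)) *
                  ∫ x, ‖G x‖) ∧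
              FokkerPlanck.mixedNorm (FokkerPlanck.gaussMeasure n)
                  (FokkerPlanck.galerkinApprox m t) ≤
                ENNReal.ofReal ((C * (1 + t) ^ (-(n : ℝ) / 2) + C_N * Real.exp (-ε * t)) *
                  ∫ x, ‖G x‖) := by
  open FokkerPlanck in
  have hδ := crossConst_pos hn
  have hs0 : 0 < s := lt_of_le_of_lt n.cast_nonneg hs
  have hI : 0 ≤ ∫ ξ : Space n, (1 + ‖ξ‖ ^ 2) ^ (-s / 2) :=
    integral_nonneg fun ξ => Real.rpow_nonneg (by positivity) _
  refine ⟨Real.sqrt 3 * (Real.exp (crossConst n / 12) *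
    (Real.pi / (crossConst n / 12)) ^ ((n : ℝ) / 2)), by positivity, fun N hN => ?_⟩
  -- The added 1 serves only to make the positivity of the constant immediate.
  refine ⟨Real.sqrt 3 * (∫ ξ : Space n, (1 + ‖ξ‖ ^ 2) ^ (-s / 2)) + 1, crossConst n / 12,
    by positivity, by positivity, fun F G hFG m hm t ht => ?_⟩
  have hN1 := one_le_of_isStronglyStable hn hN
  have hG : 0 ≤ ∫ x, ‖G x‖ := integral_nonneg fun x => norm_nonneg _
  refine mixedNorm_galerkinApprox_le ?_
  have h1 : ∀ᵐ ξ, ‖weightVec fun α => lpHat (m t α) ξ‖ ≤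
      Real.sqrt 3 * (∫ x, ‖G x‖) * majorant n s t ξ := by
    filter_upwards [norm_weightVec_lpHat_le hn hN1 hFG hm ht] with ξ hξ
    refine hξ.trans ?_
    calc _ = Real.sqrt 3 * (∫ x, ‖G x‖) *
          (Real.exp (-decayRate n (2 * Real.pi * ‖ξ‖) / 2 * t) *
            japaneseWeight s (2 * Real.pi * ‖ξ‖)) := by ring
      _ ≤ _ := mul_le_mul_of_nonneg_left (exp_mul_japaneseWeight_le hn hs0 ht ξ) (by positivity)
  filter_upwards [norm_weightVec_le_integral ((integrable_majorant hn hs ht).const_mul _) h1]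
    with x hx
  refine hx.trans ?_
  rw [integral_const_mul, integral_majorant hn hs ht, mul_comm (Real.sqrt 3), mul_assoc,
    mul_comm (∫ x, ‖G x‖)]
  refine mul_le_mul_of_nonneg_right ?_ hG
  have h2 := Real.exp_pos (-(crossConst n / 12) * t)
  nlinarith
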